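/- **Setting.** Let $n\ge 2$ and let $\mathcal M_n$ be the finite set of CPDAGs on the vertices $1,\dots,n$. Two DAGs are Markov equivalent if they have the same adjacencies and the same v-structures ($x\to y\leftarrow z$ with $x\neq z$ not adjacent). The CPDAG of an equivalence class (MEC) has $x\to y$ if every DAG of the class has $x\to y$, and $x-y$ if some DAG of the class has $x\to y$ and another has $y\to x$; CPDAGs and MECs are identified. The completion of a partially directed graph is the CPDAG of the class of DAGs with the same adjacencies and v-structures, if there is such a DAG. For $\gamma\in\mathcal M_n$, non-adjacent $x\ne y$, and a set $T$ of undirected neighbours of $y$ that are not adjacent to $x$, $\operatorname{Insert}(\gamma,x,y,T)$ is the completion (if it exists) of the graph obtained from $\gamma$ by adding $x\to y$ and directing $t-y$ as $t\to y$ for $t\in T$. For $x-y$ or $x\to y$ in $\gamma$ and a set $H$ of undirected neighbours of $y$ that are adjacent to $x$, $\operatorname{Delete}(\gamma,x,y,H)$ is the completion (if it exists) of the graph obtained from $\gamma$ by deleting the edge between $x$ and $y$ and directing, for $h\in H$, the undirected edges among $x-h$, $y-h$ as $x\to h$, $y\to h$. A move from $\gamma$ to $\eta$ is local if some DAG in the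 class of $\gamma$ becomes a DAG in the class of $\eta$ by inserting or deleting a single edge. $\operatorname{Insert}(\gamma)$ and $\operatorname{Delete}(\gamma)$ denote the sets of all $\eta\in\mathcal M_n$ that arise from $\gamma$ by a local move that is given by an Insert, respectively a Delete, operator. Let $g\colon[0,\infty)\to[0,\infty)$ satisfy $g(t)=t\,g(1/t)$ and $g(t)>0$ for all $t>0$, and let $\pi$ be a probability distribution on $\mathcal M_n$. On $S=\mathcal M_n\times\{+1,-1\}$, with elements written $\gamma^d=(\gamma,d)$, define the rates $$\lambda(\gamma^{+1}\curvearrowright\eta^{+1})=g\Big(\frac{\pi\{\eta\}}{\pi\{\gamma\}}\Big)\ \text{if }\eta\in\operatorname{Insert}(\gamma),\qquad \lambda(\gamma^{-1}\curvearrowright\eta^{-1})=g\Big(\frac{\pi\{\eta\}}{\pi\{\gamma\}}\Big)\ \text{if }\eta\in\operatorname{Delete}(\gamma),$$ $$\lambda(\gamma^{d}\curvearrowright\gamma^{-d})=\Big(-\sum_{\eta}\lambda(\gamma^d\curvearrowright\eta^d)+\sum_\eta\lambda(\gamma^{-d}\curvearrowright\eta^{-d})\Big)^+,$$ and $\lambda=0$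 in all other cases. Let $Z=(Z_t)_{t\ge0}$ be a time-homogeneous Markov jump process on $S$ with these specific rates and an arbitrary initial distribution: it has the Markov property, its paths are almost surely right-continuous with isolated jumps, and, with $\Lambda(a)=\sum_b\lambda(a\curvearrowright b)$, given that it is in state $a$ at time $0$ or at a jump time, and given the past, the time to its next jump is exponential with rate $\Lambda(a)$ and, independently, the next state is $b$ with probability $\lambda(a\curvearrowright b)/\Lambda(a)$. **Theorem (Causal Zig-Zag ergodicity).** Suppose $\pi\{\gamma\}>0$ for all $\gamma\in\mathcal M_n$. Then: 1. $Z$ is irreducible: $\mathbb P(Z_s=a)>0$ for all $s>0$, $a\in S$, and $\mathbb P(Z_t=b\mid Z_s=a)>0$ for all $a,b\in S$ and $0\le s<t$ with $\mathbb P(Z_s=a)>0$. 2. The distribution $\tilde\pi(\gamma^d)=\pi\{\gamma\}/2$ is the unique stationary distribution of $Z$, that is, the unique probability distribution $\mu$ on $S$ with $\sum_{a\in S}\mathbb P(Z_t\in B\mid Z_s=a)\,\mu\{a\}=\mu(B)$ for all $0<s<t$ and $B\subseteq S$. 3. $\lim_{t\to\infty}\mathbb P(Z_t=\gamma^d\mid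 Z_s=a)=\pi\{\gamma\}/2$ for all $\gamma\in\mathcal M_n$, $d\in\{+1,-1\}$, $a\in S$ and $s\ge0$ with $\mathbb P(Z_s=a)>0$. -/

import Mathlib

open MeasureTheory ProbabilityTheory Filter Topology
open scoped NNReal ENNReal

namespace CausalZigZag

/-! ### Partially directed graphs, DAGs, Markov equivalence and CPDAGs

A partially directed graph is a set of ordered pairs of vertices (a `Digraph`); an undirected edge
`x - y` is present as both pairs, a directed edge `x → y` as the pair `(x, y)` only. -/

section Graphs

variable {V : Type*}

/-- `x` and `y` are linked by an edge of any type. -/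
def Adjacent (G : Digraph V) (x y : V) : Prop := G.Adj x y ∨ G.Adj y x

/-- The directed edge `x → y`. -/
def Arrow (G : Digraph V) (x y : V) : Prop := G.Adj x y ∧ ¬ G.Adj y x

/-- The undirected edge `x - y`; the vertices are then called neighbours. -/
def Line (G : Digraph V) (x y : V) : Prop := G.Adj x y ∧ G.Adj y x

/-- `x → y ← z` with `x`, `z` distinct and not adjacent. -/
def IsVStructure (G : Digraph V) (x y z : V) : Prop :=
  Arrow G x y ∧ Arrow G z y ∧ x ≠ z ∧ ¬ Adjacent G x z

/-- No directed cycle (of any length at least one, so there are neither self-edges nor undirected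
edges). -/
def IsDAG (G : Digraph V) : Prop := ∀ x, ¬ Relation.TransGen G.Adj x x

/-- Same adjacencies and same v-structures. On DAGs this is Markov equivalence. -/
def SamePattern (G H : Digraph V) : Prop :=
  (∀ x y, Adjacent G x y ↔ Adjacent H x y) ∧
    ∀ x y z, IsVStructure G x y z ↔ IsVStructure H x y z

/-- The CPDAG of the Markov equivalence class of the DAG `G`: the pair `(x, y)` is present iff some
DAG of the class has `x → y`. So `x → y` in the CPDAG iff every DAG of the class has `x → y`, and
`x - y` iff one DAG of the class has `x → y` and another one has `y → x`. -/
def cpdagOf (G : Digraph V) : Digraph V where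
  Adj x y := ∃ H : Digraph V, IsDAG H ∧ SamePattern H G ∧ H.Adj x y

/-- `C` is the CPDAG of some DAG. -/
def IsCPDAG (C : Digraph V) : Prop := ∃ G : Digraph V, IsDAG G ∧ cpdagOf G = C

/-- The DAG `G` is a member of the Markov equivalence class represented by `C`. -/
def Represents (C G : Digraph V) : Prop := IsDAG G ∧ cpdagOf G = C

/-- `C` is the completion of `G`: the CPDAG of the Markov equivalence class of DAGs with the same
adjacencies and v-structures as `G`. There is none if there is no such DAG. -/
def IsCompletion (G C : Digraph V) : Prop := ∃ D : Digraph V, SamePattern D G ∧ Represents C D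

/-- `G'` arises from `G` by inserting one directed edge. -/
def IsEdgeInsertion (G G' : Digraph V) : Prop :=
  ∃ x y, ¬ G.Adj x y ∧ ∀ u v, G'.Adj u v ↔ G.Adj u v ∨ (u = x ∧ v = y)

/-- The move from the class of `C` to the class of `C'` is local: some DAG of the first class is
transformed into some DAG of the second one by a single edge insertion or deletion. -/
def IsLocalMove (C C' : Digraph V) : Prop :=
  ∃ G G', Represents C G ∧ Represents C' G' ∧ (IsEdgeInsertion G G' ∨ IsEdgeInsertion G' G)

/-- Add `x → y` to `C`, and direct the undirected edges `t - y`, `t ∈ T`, as `t → y`. -/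
def insertPDAG (C : Digraph V) (x y : V) (T : Set V) : Digraph V where
  Adj u v := (u = x ∧ v = y) ∨ (C.Adj u v ∧ ¬ (u = y ∧ v ∈ T ∧ Line C v y))

/-- Delete the edge between `x` and `y` from `C`, and, for `h ∈ H`, direct the undirected edges
`x - h` as `x → h` and `y - h` as `y → h`. -/
def deletePDAG (C : Digraph V) (x y : V) (H : Set V) : Digraph V where
  Adj u v := C.Adj u v ∧ ¬ (u = x ∧ v = y) ∧ ¬ (u = y ∧ v = x) ∧
    ¬ (u ∈ H ∧ v = x ∧ Line C x u) ∧ ¬ (u ∈ H ∧ v = y ∧ Line C y u)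

/-- `Insert(C, x, y, T)` is defined and equal to `C'`. -/
def IsInsertResult (C : Digraph V) (x y : V) (T : Set V) (C' : Digraph V) : Prop :=
  x ≠ y ∧ ¬ Adjacent C x y ∧ (∀ t ∈ T, Line C t y ∧ ¬ Adjacent C x t) ∧
    IsCompletion (insertPDAG C x y T) C'

/-- `Delete(C, x, y, H)` is defined and equal to `C'`. -/
def IsDeleteResult (C : Digraph V) (x y : V) (H : Set V) (C' : Digraph V) : Prop :=
  (Line C x y ∨ Arrow C x y) ∧ (∀ h ∈ H, Line C y h ∧ Adjacent C x h) ∧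
    IsCompletion (deletePDAG C x y H) C'

end Graphs

/-- The space of CPDAGs (equivalently, of Markov equivalence classes of DAGs) on `n` vertices. -/
abbrev CPDAG (n : ℕ) : Type := {C : Digraph (Fin n) // IsCPDAG C}

noncomputable instance instFintypeCPDAG (n : ℕ) : Fintype (CPDAG n) :=
  letI : Finite (CPDAG n) := Subtype.finite
  Fintype.ofFinite (CPDAG n)

/-- The set `Insert(γ)` of results of valid local Insert operations on `γ`. -/
def insertSet {n : ℕ} (γ : CPDAG n) : Set (CPDAG n) :=
  {η | IsLocalMove γ.1 η.1 ∧ ∃ x y T, IsInsertResult γ.1 x y T η.1}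

/-- The set `Delete(γ)` of results of valid local Delete operations on `γ`. -/
def deleteSet {n : ℕ} (γ : CPDAG n) : Set (CPDAG n) :=
  {η | IsLocalMove γ.1 η.1 ∧ ∃ x y H, IsDeleteResult γ.1 x y H η.1}

/-! ### Markov jump processes on a finite state space -/

section JumpProcess

variable {S : Type*}

/-- The jump times `0 = τ 0 < τ 1 < ...` of a right-continuous path in a discrete space; the value
is `∞` from the point on where there are no further jumps. -/
noncomputable def jumpTime (f : ℝ≥0 → S) : ℕ → ℝ≥0∞
  | 0 => 0
  | k + 1 => ⨅ (t : ℝ≥0) (_ : jumpTime f k < t ∧ f t ≠ f (jumpTime f k).toNNReal), (t : ℝ≥0∞)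

/-- The state of the path at its `k`-th jump time (used where that time is finite). -/
noncomputable def jumpState (f : ℝ≥0 → S) (k : ℕ) : S := f (jumpTime f k).toNNReal

/-- The total rate `Λ(a) = ∑ b, λ(a ↷ b)`. -/
noncomputable def totalRate [Fintype S] (rate : S → S → ℝ≥0) (a : S) : ℝ≥0 := ∑ b, rate a b

/-- The jump kernel `κ_a{b} = λ(a ↷ b) / Λ(a)`. -/
noncomputable def jumpKernel [Fintype S] (rate : S → S → ℝ≥0) (a b : S) : ℝ≥0 :=
  rate a b / totalRate rate a

variable {Ω : Type*} [MeasurableSpace Ω]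

/-- `P(Z_t = b ∣ Z_s = a)`. -/
noncomputable def transProb (P : Measure Ω) (Z : ℝ≥0 → Ω → S) (s t : ℝ≥0) (a b : S) : ℝ :=
  (P[|{ω | Z s ω = a}]).real {ω | Z t ω = b}

/-- `Z` is, under the probability measure `P` and with an arbitrary initial distribution, a
time-homogeneous Markov jump process with specific rates `rate a b = λ(a ↷ b)`. -/
structure IsMarkovJumpProcess [Fintype S] (P : Measure Ω) (Z : ℝ≥0 → Ω → S)
    (rate : S → S → ℝ≥0) : Prop where
  measurable : ∀ t a, MeasurableSet {ω | Z t ω = a}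
  /-- Almost surely the path is right-continuous for the discrete topology. -/
  rightContinuous : ∀ᵐ ω ∂P, ∀ t : ℝ≥0, ∀ᶠ u in 𝓝[≥] t, Z u ω = Z t ω
  /-- Almost surely the jumps are isolated: there are finitely many in bounded time. -/
  isolatedJumps : ∀ᵐ ω ∂P, ∀ t : ℝ≥0, ∃ k, (t : ℝ≥0∞) < jumpTime (fun u => Z u ω) k
  /-- The temporal Markov property. -/
  markov : ∀ (m : ℕ) (u : Fin m → ℝ≥0) (c : Fin m → S) (s t : ℝ≥0) (a b : S),
    (∀ i, u i ≤ s) → s ≤ t → P {ω | (∀ i, Z (u i) ω = c i) ∧ Z s ω = a} ≠ 0 →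
    (P[|{ω | (∀ i, Z (u i) ω = c i) ∧ Z s ω = a}]).real {ω | Z t ω = b} = transProb P Z s t a b
  /-- Time-homogeneity. -/
  homogeneous : ∀ (s s' h : ℝ≥0) (a b : S), P {ω | Z s ω = a} ≠ 0 → P {ω | Z s' ω = a} ≠ 0 →
    transProb P Z s (s + h) a b = transProb P Z s' (s' + h) a b
  /-- The jump times and the states at the jump times are random variables. -/
  jumpTime_measurable : ∀ k, AEMeasurable (fun ω => jumpTime (fun u => Z u ω) k) P
  jumpState_measurable : ∀ k a, NullMeasurableSet {ω | jumpState (fun u => Z u ω) k = a} P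
  /-- Given the past up to a jump (or time `0`) at which the process is in state `a`, the time to
  the next jump is exponential with rate `Λ(a)` and, independently, the next state has law `κ_a`.
  This is expressed by the joint distribution of the states at the first `k` jumps and of the
  times between them. -/
  jumpLaw : ∀ (k : ℕ) (a : ℕ → S) (r : ℕ → ℝ≥0),
    P.real {ω | (∀ i ≤ k, jumpState (fun u => Z u ω) i = a i) ∧
        ∀ i < k, jumpTime (fun u => Z u ω) (i + 1) - jumpTime (fun u => Z u ω) i ≤ (r i : ℝ≥0∞)} =
      P.real {ω | Z 0 ω = a 0} *
        ∏ i ∈ Finset.range k, (1 - Real.exp (-((totalRate rate (a i) : ℝ) * (r i : ℝ)))) *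
          (jumpKernel rate (a i) (a (i + 1)) : ℝ)

/-- `μ` is an equilibrium (stationary) distribution of `Z`: it is a probability distribution with
`∑ a, P(Z_t ∈ B ∣ Z_s = a) μ{a} = μ(B)` for all `0 < s < t` and all sets `B` of states. -/
def IsEquilibrium [Fintype S] (P : Measure Ω) (Z : ℝ≥0 → Ω → S) (μ : S → ℝ≥0) : Prop :=
  ∑ a, μ a = 1 ∧ ∀ (s t : ℝ≥0), 0 < s → s < t → ∀ B : Finset S,
    ∑ a, (P[|{ω | Z s ω = a}]).real {ω | Z t ω ∈ B} * (μ a : ℝ) = ∑ b ∈ B, (μ b : ℝ)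

end JumpProcess

/-! ### The Causal Zig-Zag process -/

/-- A balancing function: `g(t) = t g(1/t)` and `g(t) > 0` for `t > 0`. -/
structure IsBalancing (g : ℝ≥0 → ℝ≥0) : Prop where
  balance : ∀ t, 0 < t → g t = t * g (1 / t)
  pos : ∀ t, 0 < t → 0 < g t

/-- The states `γ^d = (γ, d)` with direction `d ∈ {+1, -1}`. -/
abbrev State (n : ℕ) : Type := CPDAG n × ℤˣ

open Classical in
/-- `λ(γ^d ↷ η^d)`: Insert moves in direction `+1`, Delete moves in direction `-1`. -/
noncomputable def moveRate {n : ℕ} (g : ℝ≥0 → ℝ≥0) (π : CPDAG n → ℝ≥0) (d : ℤˣ)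
    (γ η : CPDAG n) : ℝ≥0 :=
  if (d = 1 ∧ η ∈ insertSet γ) ∨ (d = -1 ∧ η ∈ deleteSet γ) then g (π η / π γ) else 0

/-- `λ(γ^d ↷ γ^{-d})`: the positive part of
`- ∑ η, λ(γ^d ↷ η^d) + ∑ η, λ(γ^{-d} ↷ η^{-d})`. -/
noncomputable def flipRate {n : ℕ} (g : ℝ≥0 → ℝ≥0) (π : CPDAG n → ℝ≥0) (d : ℤˣ)
    (γ : CPDAG n) : ℝ≥0 :=
  Real.toNNReal (-(∑ η, (moveRate g π d γ η : ℝ)) + ∑ η, (moveRate g π (-d) γ η : ℝ))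

open Classical in
/-- The specific rates `λ(a ↷ b)` of the Causal Zig-Zag process. -/
noncomputable def zigZagRate {n : ℕ} (g : ℝ≥0 → ℝ≥0) (π : CPDAG n → ℝ≥0)
    (a b : State n) : ℝ≥0 :=
  if b.2 = a.2 then moveRate g π a.2 a.1 b.1
  else if b.1 = a.1 then flipRate g π a.2 a.1
  else 0

end CausalZigZag

/-! The state space is finite, so everything reduces to two facts about the rates, namely that
positive rates connect any two states and that `π / 2` solves the balance equation, and one fact
about the process, namely that its transition probabilities are given by the exponential of the
generator.

Rates. The operators realise exactly the single edge insertions and deletions between representing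
DAGs (`mem_insertSet_iff`, `mem_deleteSet_iff`), so Insert and Delete moves are inverse to each
other, and `g(t) = t g(1/t)` gives detailed balance between them (`mul_moveRate`). If `A`, `B` are
the total move rates out of `γ` in directions `d`, `-d`, then the inflow into `γ^d` is `π(γ)(B + (A
- B)⁺)` and the outflow is `π(γ)(A + (B - A)⁺)`; both equal `π(γ) max(A, B)`. Inserting edges one by
one leads from the empty CPDAG to any CPDAG and on to the complete one. At these two ends the
direction must flip, at a positive rate, which closes the loop (`zigZagRate_irreducible`).

The delicate combinatorial point is that every edge deletion is given by a Delete operator. It needs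
that `a → b - c` in a CPDAG forces `a → c`. This follows from the completeness of Meek's rules: the
edges they leave free can be redirected along any order without immoralities, and such an order may
begin with any prescribed free edge.

Process. The rates enter through the law of the jump chain. Lack of memory of the holding times
yields the transition probabilities over short times up to a uniform quadratic error
(`IsMarkovJumpProcess.measure_inter_bounds`). With the Markov property, the transition probabilities
then solve the forward equation, whose only solution is the semigroup (`IsFlow.eq_semigroup`). For
irreducible rates all entries of the semigroup are positive at positive times, so it contracts
vectors of total mass zero (`IsFlow.tendsto_zero`). Convergence follows, and with it uniqueness of
the stationary distribution. -/

namespace CausalZigZag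

/-! ### Markov equivalence and Meek's orientation rules. -/

section Graphs

variable {V : Type*} {D G H : Digraph V} {a b c x y z : V}

theorem Adjacent.symm (h : Adjacent G x y) : Adjacent G y x := Or.symm h

theorem IsDAG.asymm (hD : IsDAG D) (h : D.Adj x y) : ¬ D.Adj y x := fun h' =>
  hD x ((Relation.TransGen.single h).tail h')

theorem IsDAG.irrefl (hD : IsDAG D) : ¬ D.Adj x x := fun h => hD x (.single h)

theorem IsDAG.ne (hD : IsDAG D) (h : D.Adj x y) : x ≠ y := by
  rintro rfl; exact hD.irrefl h

theorem IsDAG.not_adjacent_self (hD : IsDAG D) : ¬ Adjacent D x x := fun h =>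
  h.elim hD.irrefl hD.irrefl

theorem IsDAG.adj_of_path (hD : IsDAG D) (h₁ : D.Adj x y) (h₂ : D.Adj y z)
    (h : Adjacent D x z) : D.Adj x z :=
  h.resolve_right fun h' => hD x (((Relation.TransGen.single h₁).tail h₂).tail h')

theorem IsDAG.arrow (hD : IsDAG D) (h : D.Adj x y) : Arrow D x y := ⟨h, hD.asymm h⟩

theorem IsDAG.isVStructure (hD : IsDAG D) (h₁ : D.Adj x y) (h₂ : D.Adj z y) (hne : x ≠ z)
    (h : ¬ Adjacent D x z) : IsVStructure D x y z :=
  ⟨hD.arrow h₁, hD.arrow h₂, hne, h⟩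

theorem IsVStructure.symm (h : IsVStructure G x y z) : IsVStructure G z y x :=
  ⟨h.2.1, h.1, h.2.2.1.symm, fun h' => h.2.2.2 h'.symm⟩

theorem SamePattern.refl (G : Digraph V) : SamePattern G G :=
  ⟨fun _ _ => Iff.rfl, fun _ _ _ => Iff.rfl⟩

theorem SamePattern.symm (h : SamePattern G H) : SamePattern H G :=
  ⟨fun x y => (h.1 x y).symm, fun x y z => (h.2 x y z).symm⟩

theorem SamePattern.trans (h : SamePattern G H) (h' : SamePattern H D) : SamePattern G D :=
  ⟨fun x y => (h.1 x y).trans (h'.1 x y), fun x y z => (h.2 x y z).trans (h'.2 x y z)⟩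

theorem cpdagOf_eq_of_samePattern (h : SamePattern G H) : cpdagOf G = cpdagOf H := by
  ext x y
  exact ⟨fun ⟨K, hK, hs, ha⟩ => ⟨K, hK, hs.trans h, ha⟩,
    fun ⟨K, hK, hs, ha⟩ => ⟨K, hK, hs.trans h.symm, ha⟩⟩

theorem IsDAG.adj_cpdagOf (hD : IsDAG D) (h : D.Adj x y) : (cpdagOf D).Adj x y :=
  ⟨D, hD, .refl D, h⟩

theorem IsDAG.adjacent_cpdagOf (hD : IsDAG D) : Adjacent (cpdagOf D) x y ↔ Adjacent D x y := by
  constructor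
  · rintro (⟨H, -, hs, h⟩ | ⟨H, -, hs, h⟩)
    · exact (hs.1 x y).1 (Or.inl h)
    · exact (hs.1 x y).1 (Or.inr h)
  · exact Or.imp hD.adj_cpdagOf hD.adj_cpdagOf

theorem IsDAG.mono (hD : IsDAG D) (h : ∀ x y, G.Adj x y → D.Adj x y) : IsDAG G :=
  fun x hx => hD x (Relation.TransGen.mono h _ _ hx)

/-- The arrows that every DAG equivalent to `D` shares, generated by Meek's orientation rules. -/
inductive Compelled (D : Digraph V) : V → V → Prop
  | vstructure {x y z : V} : IsVStructure D x y z → Compelled D x y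
  | chain {u v w : V} : Compelled D u v → D.Adj v w → u ≠ w → ¬ Adjacent D u w →
      Compelled D v w
  | trans {u v w : V} : Compelled D u v → Compelled D v w → Adjacent D u w → Compelled D u w
  | kite {u v w k : V} : D.Adj u k → Compelled D v k → Compelled D w k → v ≠ w →
      ¬ Adjacent D v w → Adjacent D u v → Adjacent D u w → ¬ IsVStructure D v u w →
      Compelled D u k

/-- Soundness of the rules: in an equivalent DAG, the reversed edge would close a directed cycle or
complete a v-structure that `D` does not have. For `kite`, `k → u` forces `v → u ← w` by acyclicity.
-/
theorem Compelled.adj_of_samePattern (hH : IsDAG H) (hs : SamePattern H D)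
    (h : Compelled D x y) : H.Adj x y := by
  induction h with
  | vstructure h => exact ((hs.2 _ _ _).2 h).1.1
  | @chain u v w h hvw hne huw ih =>
    refine ((hs.1 v w).2 (Or.inl hvw)).resolve_right fun hwv => ?_
    have := (hs.2 u v w).1 (hH.isVStructure ih hwv hne fun h' => huw ((hs.1 _ _).1 h'))
    exact this.2.1.2 hvw
  | trans h₁ h₂ ha ih₁ ih₂ => exact hH.adj_of_path ih₁ ih₂ ((hs.1 _ _).2 ha)
  | @kite u v w k huk hv hw hne hvw huv huw hvs ihv ihw =>
    refine ((hs.1 u k).2 (Or.inl huk)).resolve_right fun hku => hvs ?_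
    refine (hs.2 v u w).1 (hH.isVStructure ?_ ?_ hne fun h' => hvw ((hs.1 _ _).1 h'))
    · exact hH.adj_of_path ihv hku ((hs.1 _ _).2 huv.symm)
    · exact hH.adj_of_path ihw hku ((hs.1 _ _).2 huw.symm)

theorem Compelled.adj (hD : IsDAG D) (h : Compelled D x y) : D.Adj x y :=
  h.adj_of_samePattern hD (.refl D)

/-- The edges of `D` that Meek's rules do not direct. -/
def Free (D : Digraph V) (x y : V) : Prop :=
  Adjacent D x y ∧ ¬ Compelled D x y ∧ ¬ Compelled D y x

theorem Free.symm (h : Free D x y) : Free D y x := ⟨h.1.symm, h.2.2, h.2.1⟩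

/-- If `a` and `c` were not adjacent, `b → c` would be compelled by the chain rule and `c → b` by
the v-structure `a → b ← c`. -/
theorem Compelled.adjacent_of_free (hD : IsDAG D) (h : Compelled D a b) (hf : Free D b c) :
    Adjacent D a c := by
  by_contra hac
  have hne : a ≠ c := by
    rintro rfl
    exact hf.2.2 h
  rcases hf.1 with hbc | hcb
  · exact hf.2.1 (h.chain hbc hne hac)
  · exact hf.2.2 (.vstructure (hD.isVStructure hcb (h.adj hD) hne.symm fun h' => hac h'.symm))

/-- An arrow into an endpoint of a free edge points to the other endpoint as well. -/
theorem Compelled.of_free (hD : IsDAG D) (h : Compelled D a b) :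
    ∀ {c}, Free D b c → Compelled D a c := by
  induction h with
  | @vstructure a b q h =>
    intro c hf
    have hab := Compelled.vstructure h
    have hqb := Compelled.vstructure h.symm
    have hac := hab.adjacent_of_free hD hf
    have hqc := hqb.adjacent_of_free hD hf
    -- Without a v-structure at `c`, neither direction of `b - c` is possible: `b → c` would create
    -- it by acyclicity, and `c → b` would be compelled by the kite rule.
    by_cases hv : IsVStructure D a c q
    · exact .vstructure hv
    rcases hf.1 with hbc | hcb
    · exact absurd (hD.isVStructure (hD.adj_of_path h.1.1 hbc hac)
        (hD.adj_of_path h.2.1.1 hbc hqc) h.2.2.1 h.2.2.2) hv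
    · exact absurd (.kite hcb hab hqb h.2.2.1 h.2.2.2 hac.symm hqc.symm hv) hf.2.2
  | @chain q a b h hab hne hqb ih =>
    intro c hf
    have hab' := h.chain hab hne hqb
    have hac := hab'.adjacent_of_free hD hf
    by_contra hn
    have hca : ¬ Compelled D c a := fun h' => hf.2.2 (h'.trans hab' hf.1.symm)
    -- The edge `a - c` would be free, so the induction hypothesis turns `q → a` into `q → c`; the
    -- free edge `c - b` then makes `q` adjacent to `b`.
    have hqc := ih ⟨hac, hn, hca⟩
    exact hqb (hqc.adjacent_of_free hD hf.symm)
  | trans h₁ h₂ ha ih₁ ih₂ =>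
    intro c hf
    exact h₁.trans (ih₂ hf) ((h₁.trans h₂ ha).adjacent_of_free hD hf)
  | @kite a v w b hab hv hw hne hvw hav haw hvs ihv ihw =>
    intro c hf
    have hac := (Compelled.kite hab hv hw hne hvw hav haw hvs).adjacent_of_free hD hf
    rcases hac with hac | hca
    · exact .kite hac (ihv hf) (ihw hf) hne hvw hav haw hvs
    · exact absurd (hD.isVStructure (hD.adj_of_path ((ihv hf).adj hD) hca hav.symm)
        (hD.adj_of_path ((ihw hf).adj hD) hca haw.symm) hne hvw) hvs

/-! ### Orders without immoralities -/

/-- Adjacent vertices have different positions, and any two earlier neighbours of a vertex are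
adjacent. -/
structure MoralOrder (L : V → V → Prop) (U : Finset V) (σ : V → ℤ) : Prop where
  ne : ∀ x ∈ U, ∀ y ∈ U, L x y → σ x ≠ σ y
  moral : ∀ x ∈ U, ∀ y ∈ U, ∀ z ∈ U, L x y → L z y → σ x < σ y → σ z < σ y → x ≠ z → L x z

/-- Any clique may be placed first, in any order. -/
theorem exists_moralOrder_initial [Fintype V] [DecidableEq V] {L : V → V → Prop}
    (hL : ∀ x y, L x y → L y x) (hirr : ∀ x, ¬ L x x) (U : Finset V) :
    ∀ {σ : V → ℤ}, MoralOrder L U σ → ∀ (C : Finset V), C ⊆ U →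
      (∀ x ∈ C, ∀ y ∈ C, x ≠ y → L x y) → ∀ ρ : V → ℤ, (∀ x ∈ C, ∀ y ∈ C, x ≠ y → ρ x ≠ ρ y) →
      ∃ σ', MoralOrder L U σ' ∧ (∀ x ∈ C, ∀ y ∈ U, y ∉ C → σ' x < σ' y) ∧
        ∀ x ∈ C, ∀ y ∈ C, ρ x < ρ y → σ' x < σ' y := by
  induction hcard : U.card generalizing U with
  | zero =>
    intro σ hσ C hC _ ρ _
    obtain rfl := Finset.card_eq_zero.1 hcard
    exact ⟨ρ, ⟨by simp, by simp⟩, by simp, fun _ _ _ _ h => h⟩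
  | succ m ih =>
    intro σ hσ C hCU hC ρ hρ
    have hU : U.Nonempty := Finset.card_pos.1 (by omega)
    -- The neighbours of the last vertex `z` form a clique, and the order stays moral without `z`.
    obtain ⟨z, hzU, hz⟩ := U.exists_max_image σ hU
    have hcard' : (U.erase z).card = m := by rw [Finset.card_erase_of_mem hzU]; omega
    have hsub : U.erase z ⊆ U := Finset.erase_subset _ _
    have hσ' : MoralOrder L (U.erase z) σ :=
      ⟨fun x hx y hy => hσ.ne x (hsub hx) y (hsub hy),
        fun x hx y hy w hw => hσ.moral x (hsub hx) y (hsub hy) w (hsub hw)⟩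
    have hlt : ∀ x ∈ U, L x z → σ x < σ z := fun x hx hxz =>
      lt_of_le_of_ne (hz x hx) (hσ.ne x hx z hzU hxz)
    have hclique : ∀ x ∈ U, ∀ y ∈ U, L x z → L y z → x ≠ y → L x y := fun x hx y hy hxz hyz =>
      hσ.moral x hx z hzU y hy hxz hyz (hlt x hx hxz) (hlt y hy hyz)
    by_cases hzC : z ∈ C
    · classical
      -- For `z ∈ C`, the clique `N` of neighbours of `z` is first moved to the front of the
      -- remaining vertices, and then `C` is put before everything. Since `C \ {z} ⊆ N`, a vertex
      -- outside `C` and `N` gains no earlier neighbour.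
      set N := (U.erase z).filter (fun x => L x z) with hN
      obtain ⟨τ, hτ, hτN, -⟩ := ih (U.erase z) hcard' hσ' N (Finset.filter_subset _ _)
        (fun x hx y hy hxy => by
          simp only [hN, Finset.mem_filter] at hx hy
          exact hclique x (hsub hx.1) y (hsub hy.1) hx.2 hy.2 hxy) σ
        (fun x hx y hy hxy => by
          simp only [hN, Finset.mem_filter] at hx hy
          exact hσ.ne x (hsub hx.1) y (hsub hy.1)
            (hclique x (hsub hx.1) y (hsub hy.1) hx.2 hy.2 hxy))
      -- A shift that puts all values of `ρ` below all values of `τ`.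
      obtain ⟨M, hM⟩ : ∃ M : ℤ, ∀ x y, ρ x - M < τ y := by
        have hf : (Set.range fun p : V × V => ρ p.1 - τ p.2).Finite := Set.finite_range _
        obtain ⟨M, hM⟩ := hf.bddAbove
        refine ⟨M + 1, fun x y => ?_⟩
        have := hM ⟨(x, y), rfl⟩
        simp only at this
        omega
      have hCN : ∀ x ∈ C, x ≠ z → x ∈ N := fun x hx hxz => by
        simp only [hN, Finset.mem_filter, Finset.mem_erase]
        exact ⟨⟨hxz, hCU hx⟩, hC x hx z hzC hxz⟩
      have hmemN : ∀ x, x ∈ N → x ∈ U ∧ x ≠ z ∧ L x z := fun x hx => by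
        simp only [hN, Finset.mem_filter, Finset.mem_erase] at hx
        exact ⟨hx.1.2, hx.1.1, hx.2⟩
      set σ' : V → ℤ := fun x => if x ∈ C then ρ x - M else τ x with hσdef
      have hin : ∀ x ∈ C, σ' x = ρ x - M := fun x hx => if_pos hx
      have hout : ∀ x, x ∉ C → σ' x = τ x := fun x hx => if_neg hx
      have hinout : ∀ x ∈ C, ∀ y, y ∉ C → σ' x < σ' y := fun x hx y hy => by
        rw [hin x hx, hout y hy]; exact hM x y
      refine ⟨σ', ⟨?_, ?_⟩, fun x hx y _ hy => hinout x hx y hy, fun x hx y hy h => ?_⟩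
      · intro x hx y hy hxy
        have hne : x ≠ y := by rintro rfl; exact hirr _ hxy
        by_cases hxC : x ∈ C <;> by_cases hyC : y ∈ C
        · rw [hin x hxC, hin y hyC]
          have := hρ x hxC y hyC hne
          omega
        · exact (hinout x hxC y hyC).ne
        · exact (hinout y hyC x hxC).ne'
        · rw [hout x hxC, hout y hyC]
          exact hτ.ne x (Finset.mem_erase.2 ⟨fun h => hxC (h ▸ hzC), hx⟩) y
            (Finset.mem_erase.2 ⟨fun h => hyC (h ▸ hzC), hy⟩) hxy
      · have key : ∀ y ∈ U, y ∉ C → y ∉ N → ∀ x ∈ U, L x y → σ' x < σ' y →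
            x ∈ U.erase z ∧ τ x < τ y := by
          intro y hy hyC hyN x hx hxy hlt'
          have hyz : y ≠ z := fun h => hyC (h ▸ hzC)
          have hxz : x ≠ z := by
            rintro rfl
            exact hyN (by simp [hN, hy, hyz, hL _ _ hxy])
          refine ⟨Finset.mem_erase.2 ⟨hxz, hx⟩, ?_⟩
          by_cases hxC : x ∈ C
          · exact hτN x (hCN x hxC hxz) y (Finset.mem_erase.2 ⟨hyz, hy⟩) hyN
          · rwa [hout x hxC, hout y hyC] at hlt'
        have keyN : ∀ y ∈ U, y ∉ C → y ∈ N → ∀ x ∈ U, L x y → σ' x < σ' y → x = z ∨ x ∈ N := by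
          intro y hy hyC hyN x hx hxy hlt'
          by_contra! hcon
          have hxC : x ∉ C := fun h => hcon.2 (hCN x h hcon.1)
          rw [hout x hxC, hout y hyC] at hlt'
          exact absurd (hτN y hyN x (Finset.mem_erase.2 ⟨hcon.1, hx⟩) hcon.2) (by omega)
        have keyC : ∀ y ∈ C, ∀ x, σ' x < σ' y → x ∈ C := by
          intro y hy x h
          by_contra hx
          exact absurd (hinout y hy x hx) (by omega)
        intro x hx y hy w hw hxy hwy hxlt hwlt hne
        by_cases hyC : y ∈ C
        · exact hC x (keyC y hyC x hxlt) w (keyC y hyC w hwlt) hne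
        by_cases hyN : y ∈ N
        · rcases keyN y hy hyC hyN x hx hxy hxlt with rfl | hxN <;>
            rcases keyN y hy hyC hyN w hw hwy hwlt with rfl | hwN
          · exact absurd rfl hne
          · exact hL _ _ (hmemN w hwN).2.2
          · exact (hmemN x hxN).2.2
          · exact hclique x hx w hw (hmemN x hxN).2.2 (hmemN w hwN).2.2 hne
        · obtain ⟨hx', hxτ⟩ := key y hy hyC hyN x hx hxy hxlt
          obtain ⟨hw', hwτ⟩ := key y hy hyC hyN w hw hwy hwlt
          exact hτ.moral x hx' y (Finset.mem_erase.2 ⟨fun h => hyC (h ▸ hzC), hy⟩) w hw'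
            hxy hwy hxτ hwτ hne
      · rw [hin x hx, hin y hy]; omega
    -- For `z ∉ C`, the vertex `z` may stay last, because its neighbours form a clique.
    · have hCe : C ⊆ U.erase z := fun x hx =>
        Finset.mem_erase.2 ⟨fun h => hzC (h ▸ hx), hCU hx⟩
      obtain ⟨τ, hτ, hτC, hτρ⟩ := ih (U.erase z) hcard' hσ' C hCe hC ρ hρ
      obtain ⟨M, hM⟩ : ∃ M : ℤ, ∀ x, τ x < M := by
        obtain ⟨M, hM⟩ := (Set.finite_range τ).bddAbove
        exact ⟨M + 1, fun x => by have := hM ⟨x, rfl⟩; omega⟩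
      have hz' : Function.update τ z M z = M := Function.update_self _ _ _
      have hnz : ∀ x, x ≠ z → Function.update τ z M x = τ x := fun x hx =>
        Function.update_of_ne hx _ _
      have hle : ∀ x, Function.update τ z M x ≤ M := fun x => by
        by_cases hx : x = z
        · rw [hx, hz']
        · rw [hnz x hx]; exact (hM x).le
      refine ⟨Function.update τ z M, ⟨?_, ?_⟩, ?_, ?_⟩
      · intro x hx y hy hxy
        have hne : x ≠ y := by rintro rfl; exact hirr _ hxy
        by_cases hxz : x = z
        · subst hxz
          rw [hz', hnz y hne.symm]; exact (hM y).ne'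
        by_cases hyz : y = z
        · subst hyz
          rw [hz', hnz x hne]; exact (hM x).ne
        rw [hnz x hxz, hnz y hyz]
        exact hτ.ne x (Finset.mem_erase.2 ⟨hxz, hx⟩) y (Finset.mem_erase.2 ⟨hyz, hy⟩) hxy
      · intro x hx y hy w hw hxy hwy hxlt hwlt hne
        by_cases hyz : y = z
        · subst hyz
          exact hclique x hx w hw hxy hwy hne
        have hlt' : ∀ v, Function.update τ z M v < Function.update τ z M y →
            v ≠ z ∧ τ v < τ y := fun v hv => by
          have hvz : v ≠ z := by
            rintro rfl
            rw [hz'] at hv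
            exact absurd (hle y) (by omega)
          rw [hnz v hvz, hnz y hyz] at hv
          exact ⟨hvz, hv⟩
        exact hτ.moral x (Finset.mem_erase.2 ⟨(hlt' x hxlt).1, hx⟩) y
          (Finset.mem_erase.2 ⟨hyz, hy⟩) w (Finset.mem_erase.2 ⟨(hlt' w hwlt).1, hw⟩) hxy hwy
          (hlt' x hxlt).2 (hlt' w hwlt).2 hne
      · intro x hx y hy hyC
        have hxz : x ≠ z := fun h => hzC (h ▸ hx)
        rw [hnz x hxz]
        by_cases hyz : y = z
        · subst hyz; rw [hz']; exact hM x
        · rw [hnz y hyz]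
          exact hτC x hx y (Finset.mem_erase.2 ⟨hyz, hy⟩) hyC
      · intro x hx y hy h
        rw [hnz x fun h => hzC (h ▸ hx), hnz y fun h => hzC (h ▸ hy)]
        exact hτρ x hx y hy h

end Graphs

/-! ### Completeness of Meek's rules, by redirecting the free edges. -/

section Graphs

variable {V : Type*} {D G G' H : Digraph V} {a b c x y z : V}

theorem IsDAG.exists_topologicalOrder [Finite V] (hD : IsDAG D) :
    ∃ σ : V → ℤ, ∀ x y, D.Adj x y → σ x < σ y := by
  classical
  have := Fintype.ofFinite V
  refine ⟨fun x => ((Finset.univ.filter fun y => Relation.TransGen D.Adj y x).card : ℤ),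
    fun x y h => ?_⟩
  simp only [Nat.cast_lt]
  refine Finset.card_lt_card ⟨fun w hw => ?_, fun hsub => ?_⟩
  · simp only [Finset.mem_filter, Finset.mem_univ, true_and] at hw ⊢
    exact hw.tail h
  · have := hsub (by simpa using Relation.TransGen.single h : x ∈ _)
    simp only [Finset.mem_filter, Finset.mem_univ, true_and] at this
    exact hD x this

theorem Compelled.irrefl_transGen (hD : IsDAG D) : ¬ Relation.TransGen (Compelled D) x x :=
  fun h => hD x (Relation.TransGen.mono (fun _ _ h => h.adj hD) _ _ h)

theorem transGen_compelled_of_free (hD : IsDAG D) (h : Relation.TransGen (Compelled D) a b)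
    (hf : Free D b c) : Relation.TransGen (Compelled D) a c := by
  cases h with
  | single h => exact .single (h.of_free hD hf)
  | tail h h' => exact h.tail (h'.of_free hD hf)

theorem transGen_compelled_of_freePath (hD : IsDAG D) (h : Relation.TransGen (Compelled D) a b)
    (hf : Relation.ReflTransGen (Free D) b c) : Relation.TransGen (Compelled D) a c := by
  induction hf with
  | refl => exact h
  | tail _ hf ih => exact transGen_compelled_of_free hD ih hf

/-- The reorientation of the free edges of `D` along `σ`. -/
def reorient (D : Digraph V) (σ : V → ℤ) : Digraph V where
  Adj x y := Compelled D x y ∨ (Free D x y ∧ σ x < σ y)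

/-- Any `σ` will do. A compelled arrow followed by a free edge can be replaced by a compelled arrow
into the far end. So a directed path either is free, with `σ` increasing along it, or can be
replaced by a free path followed by compelled arrows. A cycle of the second kind becomes a compelled
cycle, hence a cycle of `D`. -/
theorem isDAG_reorient (hD : IsDAG D) (σ : V → ℤ) : IsDAG (reorient D σ) := by
  have key : ∀ x y, Relation.TransGen (reorient D σ).Adj x y →
      (Relation.ReflTransGen (Free D) x y ∧ σ x < σ y) ∨
        ∃ z, Relation.ReflTransGen (Free D) x z ∧ Relation.TransGen (Compelled D) z y := by
    intro x y h
    induction h with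
    | single h =>
      rcases h with h | ⟨h, hσ⟩
      · exact Or.inr ⟨x, .refl, .single h⟩
      · exact Or.inl ⟨.single h, hσ⟩
    | tail _ h ih =>
      rcases h with h | ⟨h, hσ⟩ <;> rcases ih with ⟨hp, hlt⟩ | ⟨z, hz, hc⟩
      · exact Or.inr ⟨_, hp, .single h⟩
      · exact Or.inr ⟨z, hz, hc.tail h⟩
      · exact Or.inl ⟨hp.tail h, hlt.trans hσ⟩
      · exact Or.inr ⟨z, hz, transGen_compelled_of_free hD hc h⟩
  intro x hx
  rcases key x x hx with ⟨-, h⟩ | ⟨z, hz, hc⟩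
  · exact lt_irrefl _ h
  · exact Compelled.irrefl_transGen hD (transGen_compelled_of_freePath hD hc hz)

theorem adjacent_iff_compelled_or_free (hD : IsDAG D) :
    Adjacent D x y ↔ Compelled D x y ∨ Compelled D y x ∨ Free D x y := by
  constructor
  · intro h
    by_cases h₁ : Compelled D x y
    · exact Or.inl h₁
    by_cases h₂ : Compelled D y x
    · exact Or.inr (Or.inl h₂)
    · exact Or.inr (Or.inr ⟨h, h₁, h₂⟩)
  · rintro (h | h | h)
    · exact Or.inl (h.adj hD)
    · exact Or.inr (h.adj hD)
    · exact h.1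

/-- In a v-structure of the new graph, two free edges are excluded by morality, and a free edge next
to a compelled one by `Compelled.adjacent_of_free`. Two compelled arrows belong to `D` already. -/
theorem samePattern_reorient [Fintype V] (hD : IsDAG D) {σ : V → ℤ}
    (hσ : MoralOrder (Free D) Finset.univ σ) : SamePattern (reorient D σ) D := by
  have hadj : ∀ x y, Adjacent (reorient D σ) x y ↔ Adjacent D x y := by
    intro x y
    rw [adjacent_iff_compelled_or_free hD]
    constructor
    · rintro ((h | h) | (h | h))
      · exact Or.inl h
      · exact Or.inr (Or.inr h.1)
      · exact Or.inr (Or.inl h)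
      · exact Or.inr (Or.inr h.1.symm)
    · rintro (h | h | h)
      · exact Or.inl (Or.inl h)
      · exact Or.inr (Or.inl h)
      · rcases lt_or_gt_of_ne (hσ.ne x (Finset.mem_univ _) y (Finset.mem_univ _) h) with h' | h'
        · exact Or.inl (Or.inr ⟨h, h'⟩)
        · exact Or.inr (Or.inr ⟨h.symm, h'⟩)
  refine ⟨hadj, fun x y z => ⟨?_, fun h => ?_⟩⟩
  · rintro ⟨⟨hx, -⟩, ⟨hz, -⟩, hne, hxz⟩
    rw [hadj] at hxz
    rcases hx with hx | ⟨hx, hxσ⟩ <;> rcases hz with hz | ⟨hz, hzσ⟩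
    · exact hD.isVStructure (hx.adj hD) (hz.adj hD) hne hxz
    · exact absurd (hx.adjacent_of_free hD hz.symm) hxz
    · exact absurd (hz.adjacent_of_free hD hx.symm).symm hxz
    · exact absurd (hσ.moral x (Finset.mem_univ _) y (Finset.mem_univ _) z (Finset.mem_univ _)
        hx hz hxσ hzσ hne).1 hxz
  · exact (isDAG_reorient hD σ).isVStructure (Or.inl (.vstructure h)) (Or.inl (.vstructure h.symm))
      h.2.2.1 fun h' => h.2.2.2 ((hadj _ _).1 h')

/-- Either orientation of a free edge occurs in the equivalence class. -/
theorem Free.exists_adj [Fintype V] (hD : IsDAG D) (h : Free D x y) :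
    ∃ H, IsDAG H ∧ SamePattern H D ∧ H.Adj x y := by
  classical
  obtain ⟨σ, hσ⟩ := hD.exists_topologicalOrder
  have hor : ∀ x y, Free D x y → σ x < σ y → D.Adj x y := fun x y hf hlt =>
    hf.1.resolve_right fun h' => absurd (hσ _ _ h') (by omega)
  -- Two free parents are adjacent, as otherwise they would form a v-structure. The edge between
  -- them is free, as otherwise `Compelled.of_free` would make one of the two free edges compelled.
  have hmoral : MoralOrder (Free D) Finset.univ σ := by
    refine ⟨fun x _ y _ hf => ?_, fun x _ y _ z _ hx hz hxσ hzσ hne => ?_⟩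
    · rcases hf.1 with h' | h'
      · exact (hσ _ _ h').ne
      · exact (hσ _ _ h').ne'
    · refine ⟨?_, fun hc => hx.2.1 (hc.of_free hD hz), fun hc => hz.2.1 (hc.of_free hD hx)⟩
      by_contra hxz
      exact hx.2.1 (.vstructure (hD.isVStructure (hor _ _ hx hxσ) (hor _ _ hz hzσ) hne hxz))
  have hxy : x ≠ y := by
    rintro rfl; exact hD.not_adjacent_self h.1
  -- The ends of a free edge form a clique, so a moral order can start with `x`, `y`.
  obtain ⟨τ, hτ, -, hτxy⟩ := exists_moralOrder_initial (fun _ _ => Free.symm)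
    (fun x hx => hD.not_adjacent_self hx.1) Finset.univ hmoral {x, y} (Finset.subset_univ _)
    (fun u hu v hv huv => by
      simp only [Finset.mem_insert, Finset.mem_singleton] at hu hv
      rcases hu with rfl | rfl <;> rcases hv with rfl | rfl
      · exact absurd rfl huv
      · exact h
      · exact h.symm
      · exact absurd rfl huv)
    (fun w => if w = x then 0 else 1)
    (fun u hu v hv huv => by
      simp only [Finset.mem_insert, Finset.mem_singleton] at hu hv
      rcases hu with rfl | rfl <;> rcases hv with rfl | rfl
      · exact absurd rfl huv
      · simp [huv.symm]
      · simp [huv]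
      · exact absurd rfl huv)
  exact ⟨reorient D τ, isDAG_reorient hD τ, samePattern_reorient hD hτ,
    Or.inr ⟨h, hτxy x (by simp) y (by simp) (by simp [hxy.symm])⟩⟩

theorem Free.line_cpdagOf [Fintype V] (hD : IsDAG D) (h : Free D x y) : Line (cpdagOf D) x y :=
  ⟨h.exists_adj hD, h.symm.exists_adj hD⟩

theorem Compelled.arrow_cpdagOf (hD : IsDAG D) (h : Compelled D x y) : Arrow (cpdagOf D) x y :=
  ⟨hD.adj_cpdagOf (h.adj hD), fun ⟨_, hH, hs, hyx⟩ => hH.asymm hyx (h.adj_of_samePattern hH hs)⟩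

theorem arrow_cpdagOf_iff [Fintype V] (hD : IsDAG D) :
    Arrow (cpdagOf D) x y ↔ Compelled D x y := by
  refine ⟨fun h => ?_, fun h => h.arrow_cpdagOf hD⟩
  rcases (adjacent_iff_compelled_or_free hD).1 (hD.adjacent_cpdagOf.1 (Or.inl h.1)) with h' | h' | h'
  · exact h'
  · exact absurd (h'.arrow_cpdagOf hD).1 h.2
  · exact absurd (h'.line_cpdagOf hD).2 h.2

theorem line_cpdagOf_iff [Fintype V] (hD : IsDAG D) : Line (cpdagOf D) x y ↔ Free D x y := by
  refine ⟨fun h => ?_, fun h => h.line_cpdagOf hD⟩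
  rcases (adjacent_iff_compelled_or_free hD).1 (hD.adjacent_cpdagOf.1 (Or.inl h.1)) with h' | h' | h'
  · exact absurd h.2 (h'.arrow_cpdagOf hD).2
  · exact absurd h.1 (h'.arrow_cpdagOf hD).2
  · exact h'

/-- In a CPDAG, an arrow into an endpoint of an undirected edge points to the other endpoint as
well. -/
theorem Arrow.of_line_cpdagOf [Fintype V] (hD : IsDAG D) (h : Arrow (cpdagOf D) a b)
    (hl : Line (cpdagOf D) b c) : Arrow (cpdagOf D) a c := by
  rw [arrow_cpdagOf_iff hD] at *
  exact h.of_free hD ((line_cpdagOf_iff hD).1 hl)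

theorem Arrow.adj_of_cpdagOf (hD : IsDAG D) (h : Arrow (cpdagOf D) x y) : D.Adj x y :=
  (hD.adjacent_cpdagOf.1 (Or.inl h.1)).resolve_right fun h' => h.2 (hD.adj_cpdagOf h')

theorem IsVStructure.arrow_cpdagOf (hD : IsDAG D) (h : IsVStructure D x y z) :
    Arrow (cpdagOf D) x y := (Compelled.vstructure h).arrow_cpdagOf hD

theorem IsDAG.arrow_or_line (hD : IsDAG D) (h : D.Adj x y) :
    Arrow (cpdagOf D) x y ∨ Line (cpdagOf D) x y := by
  by_cases h' : (cpdagOf D).Adj y x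
  · exact Or.inr ⟨hD.adj_cpdagOf h, h'⟩
  · exact Or.inl ⟨hD.adj_cpdagOf h, h'⟩

/-! ### The operators realise single edge insertions and deletions. -/

/-- Two graphs with the same adjacencies have the same v-structures if the arrows of the first are
arrows of the second one and the second has no further v-structures. -/
theorem samePattern_of_arrow {P : Digraph V} (hadj : ∀ x y, Adjacent P x y ↔ Adjacent G x y)
    (harr : ∀ x y, Arrow P x y → Arrow G x y)
    (hvs : ∀ x y z, IsVStructure G x y z → Arrow P x y) : SamePattern G P := by
  refine ⟨fun x y => (hadj x y).symm, fun x y z => ⟨fun h => ?_, fun h => ?_⟩⟩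
  · exact ⟨hvs x y z h, hvs z y x h.symm, h.2.2.1, fun h' => h.2.2.2 ((hadj _ _).1 h')⟩
  · exact ⟨harr _ _ h.1, harr _ _ h.2.1, h.2.2.1, fun h' => h.2.2.2 ((hadj _ _).2 h')⟩

/-- The v-structures created by `x → y` are `x → y ← t` with `t` a parent of `y` not adjacent to
`x`. The set `T` consists of those `t` whose edge to `y` is undirected in the CPDAG and has to be
directed by the operator. -/
theorem exists_isInsertResult (hG : IsDAG G) (hG' : IsDAG G') (h : IsEdgeInsertion G G') :
    ∃ x y T, IsInsertResult (cpdagOf G) x y T (cpdagOf G') := by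
  obtain ⟨x, y, hxy, h⟩ := h
  have hxy' : G'.Adj x y := (h x y).2 (Or.inr ⟨rfl, rfl⟩)
  have hle : ∀ {u v}, G.Adj u v → G'.Adj u v := fun {u v} huv => (h u v).2 (Or.inl huv)
  have hna : ¬ Adjacent G x y := fun h' => h'.elim hxy fun h' => hG'.asymm hxy' (hle h')
  have hne : x ≠ y := hG'.ne hxy'
  set C := cpdagOf G with hC
  set T : Set V := {t | Line C t y ∧ G.Adj t y ∧ ¬ Adjacent C x t} with hT
  have hP : ∀ u v, (insertPDAG C x y T).Adj u v ↔
      (u = x ∧ v = y) ∨ (C.Adj u v ∧ ¬ (u = y ∧ v ∈ T ∧ Line C v y)) := fun _ _ => Iff.rfl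
  have hCadj : ∀ {u v}, Adjacent C u v ↔ Adjacent G u v := hG.adjacent_cpdagOf
  have hG'adj : ∀ u v, Adjacent G' u v ↔
      Adjacent G u v ∨ (u = x ∧ v = y) ∨ (v = x ∧ u = y) := fun u v => by
    simp only [Adjacent, h]; tauto
  refine ⟨x, y, T, hne, fun h' => hna (hCadj.1 h'), fun t ht => ⟨ht.1, ht.2.2⟩, G', ?_, hG', rfl⟩
  refine samePattern_of_arrow (fun u v => ?_) (fun u v huv => ?_) fun u v w hvs => ?_
  · rw [hG'adj, ← hCadj]
    constructor
    · rintro (h' | h') <;> rw [hP] at h' <;> rcases h' with h' | h'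
      · exact Or.inr (Or.inl h')
      · exact Or.inl (Or.inl h'.1)
      · exact Or.inr (Or.inr h')
      · exact Or.inl (Or.inr h'.1)
    · rintro (h' | h' | h')
      · by_cases hd : u = y ∧ v ∈ T ∧ Line C v y
        · refine Or.inr ((hP _ _).2 (Or.inr ?_))
          obtain ⟨rfl, hv, hl⟩ := hd
          refine ⟨hl.1, fun h'' => ?_⟩
          obtain ⟨rfl, -, -⟩ := h''
          exact hG.irrefl hv.2.1
        · by_cases hd' : v = y ∧ u ∈ T ∧ Line C u y
          · obtain ⟨rfl, hv, hl⟩ := hd'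
            exact Or.inl ((hP _ _).2 (Or.inr ⟨hl.1, hd⟩))
          · rcases h' with h' | h'
            · exact Or.inl ((hP _ _).2 (Or.inr ⟨h', hd⟩))
            · exact Or.inr ((hP _ _).2 (Or.inr ⟨h', hd'⟩))
      · exact Or.inl ((hP _ _).2 (Or.inl h'))
      · exact Or.inr ((hP _ _).2 (Or.inl h'))
  · refine hG'.arrow ?_
    obtain ⟨huv, hvu⟩ := huv
    rw [hP] at huv hvu
    push Not at hvu
    rcases huv with ⟨rfl, rfl⟩ | ⟨huv, -⟩
    · exact hxy'
    by_cases hvu' : C.Adj v u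
    · obtain ⟨rfl, hu, -⟩ := hvu.2 hvu'
      exact hle hu.2.1
    · exact hle (Arrow.adj_of_cpdagOf hG ⟨huv, hvu'⟩)
  · have key : ∀ {u}, Arrow C u v → Arrow (insertPDAG C x y T) u v := by
      intro u hu
      refine ⟨(hP _ _).2 (Or.inr ⟨hu.1, fun h' => hu.2 (by rw [h'.1]; exact h'.2.2.1)⟩), fun h' => ?_⟩
      rcases (hP _ _).1 h' with ⟨rfl, rfl⟩ | h'
      · exact hna (hCadj.1 (Or.inr hu.1))
      · exact hu.2 h'.1
    obtain ⟨⟨huv, -⟩, ⟨hwv, -⟩, hne', huw⟩ := hvs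
    rw [hG'adj] at huw
    push Not at huw
    rcases (h u v).1 huv with huv | ⟨rfl, rfl⟩
    · rcases (h w v).1 hwv with hwv | ⟨rfl, rfl⟩
      · exact key ((hG.isVStructure huv hwv hne' huw.1).arrow_cpdagOf hG)
      · rcases hG.arrow_or_line huv with ha | hl
        · exact key ha
        · have huT : u ∈ T := ⟨hl, huv, fun h' => huw.1 (hCadj.1 h').symm⟩
          refine ⟨(hP _ _).2 (Or.inr ⟨hl.1, fun h' => hG.ne huv h'.1⟩), fun h' => ?_⟩
          rcases (hP _ _).1 h' with ⟨rfl, -⟩ | h'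
          · exact hne rfl
          · exact h'.2 ⟨rfl, huT, hl⟩
    · refine ⟨(hP _ _).2 (Or.inl ⟨rfl, rfl⟩), fun h' => ?_⟩
      rcases (hP _ _).1 h' with ⟨rfl, -⟩ | h'
      · exact hne rfl
      · exact hna (hCadj.1 (Or.inr h'.1))

/-- Deleting `x → y` creates v-structures at the common children of `x` and `y`. The set `T`
consists of the children `t` of `y` that are adjacent to `x` and whose edge to `y` is undirected in
the CPDAG; then `x → t` by acyclicity, so these are common children. -/
theorem exists_isDeleteResult [Fintype V] (hG : IsDAG G) (hG' : IsDAG G')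
    (h : IsEdgeInsertion G G') :
    ∃ x y T, IsDeleteResult (cpdagOf G') x y T (cpdagOf G) := by
  obtain ⟨x, y, hxy, h⟩ := h
  have hxy' : G'.Adj x y := (h x y).2 (Or.inr ⟨rfl, rfl⟩)
  have hle : ∀ {u v}, G.Adj u v → G'.Adj u v := fun {u v} huv => (h u v).2 (Or.inl huv)
  have hna : ¬ Adjacent G x y := fun h' => h'.elim hxy fun h' => hG'.asymm hxy' (hle h')
  have hne : x ≠ y := hG'.ne hxy'
  set C := cpdagOf G' with hC
  set T : Set V := {t | Line C y t ∧ Adjacent C x t ∧ G'.Adj y t} with hT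
  have hP : ∀ u v, (deletePDAG C x y T).Adj u v ↔ C.Adj u v ∧ ¬ (u = x ∧ v = y) ∧
      ¬ (u = y ∧ v = x) ∧ ¬ (u ∈ T ∧ v = x ∧ Line C x u) ∧ ¬ (u ∈ T ∧ v = y ∧ Line C y u) :=
    fun _ _ => Iff.rfl
  have hCadj : ∀ {u v}, Adjacent C u v ↔ Adjacent G' u v := hG'.adjacent_cpdagOf
  have hG'adj : ∀ u v, Adjacent G' u v ↔
      Adjacent G u v ∨ (u = x ∧ v = y) ∨ (v = x ∧ u = y) := fun u v => by
    simp only [Adjacent, h]; tauto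
  have hGadj : ∀ u v, Adjacent G u v ↔
      Adjacent G' u v ∧ ¬ (u = x ∧ v = y) ∧ ¬ (v = x ∧ u = y) := fun u v => by
    rw [hG'adj]
    constructor
    · refine fun h' => ⟨Or.inl h', ?_, ?_⟩
      · rintro ⟨rfl, rfl⟩; exact hna h'
      · rintro ⟨rfl, rfl⟩; exact hna h'.symm
    · rintro ⟨h' | h' | h', h₁, h₂⟩
      · exact h'
      · exact absurd h' h₁
      · exact absurd h' h₂
  have hxT : x ∉ T := fun h' => hG'.not_adjacent_self (hCadj.1 h'.2.1)
  have hyT : y ∉ T := fun h' => hG'.irrefl h'.2.2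
  have hxt : ∀ {t}, t ∈ T → G'.Adj x t := fun {t} ht =>
    hG'.adj_of_path hxy' ht.2.2 (hCadj.1 ht.2.1)
  have hor : Line C x y ∨ Arrow C x y := (hG'.arrow_or_line hxy').symm
  refine ⟨x, y, T, hor, fun t ht => ⟨ht.1, ht.2.1⟩, G, ?_, hG, rfl⟩
  refine samePattern_of_arrow (fun u v => ?_) (fun u v huv => ?_) fun u v w hvs => ?_
  · rw [hGadj, ← hCadj]
    have aux : ∀ u v, C.Adj u v → ¬ (u = x ∧ v = y) → ¬ (v = x ∧ u = y) →
        Adjacent (deletePDAG C x y T) u v := by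
      intro u v huv h₁ h₂
      by_cases hd : (deletePDAG C x y T).Adj u v
      · exact Or.inl hd
      refine Or.inr ((hP _ _).2 ?_)
      have hd' : (u ∈ T ∧ v = x ∧ Line C x u) ∨ (u ∈ T ∧ v = y ∧ Line C y u) := by
        by_contra hcon
        push Not at hcon
        exact hd ((hP _ _).2 ⟨huv, h₁, fun h' => h₂ h'.symm, fun h' => hcon.1 h'.1 h'.2.1 h'.2.2,
          fun h' => hcon.2 h'.1 h'.2.1 h'.2.2⟩)
      have hvT : v ∉ T := by
        rcases hd' with ⟨-, rfl, -⟩ | ⟨-, rfl, -⟩ <;> assumption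
      refine ⟨?_, h₂, fun h' => h₁ h'.symm, fun h' => hvT h'.1, fun h' => hvT h'.1⟩
      rcases hd' with ⟨-, rfl, hl⟩ | ⟨-, rfl, hl⟩ <;> exact hl.1
    constructor
    · rintro (h' | h') <;> obtain ⟨h₁, h₂, h₃, -⟩ := (hP _ _).1 h'
      · exact ⟨Or.inl h₁, h₂, fun h' => h₃ h'.symm⟩
      · exact ⟨Or.inr h₁, fun h' => h₃ h'.symm, h₂⟩
    · rintro ⟨h' | h', h₁, h₂⟩
      · exact aux u v h' h₁ h₂
      · exact (aux v u h' h₂ h₁).symm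
  · refine hG.arrow ?_
    obtain ⟨huv, hvu⟩ := huv
    obtain ⟨huv, h₁, h₂, -⟩ := (hP _ _).1 huv
    suffices h' : G'.Adj u v from ((h u v).1 h').resolve_right h₁
    by_cases hvu' : C.Adj v u
    · have hd' : (v ∈ T ∧ u = x ∧ Line C x v) ∨ (v ∈ T ∧ u = y ∧ Line C y v) := by
        by_contra hcon
        push Not at hcon
        exact hvu ((hP _ _).2 ⟨hvu', fun h' => h₂ h'.symm, fun h' => h₁ h'.symm,
          fun h' => hcon.1 h'.1 h'.2.1 h'.2.2, fun h' => hcon.2 h'.1 h'.2.1 h'.2.2⟩)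
      rcases hd' with ⟨hv, rfl, -⟩ | ⟨hv, rfl, -⟩
      · exact hxt hv
      · exact hv.2.2
    · exact Arrow.adj_of_cpdagOf hG' ⟨huv, hvu'⟩
  · have key : ∀ {u}, G.Adj u v → Arrow C u v → Arrow (deletePDAG C x y T) u v := by
      intro u hGu hu
      have hn := (hGadj u v).1 (Or.inl hGu)
      refine ⟨(hP _ _).2 ⟨hu.1, hn.2.1, fun h' => hn.2.2 h'.symm, fun h' => ?_, fun h' => ?_⟩,
        fun h' => hu.2 ((hP _ _).1 h').1⟩
      · obtain ⟨-, rfl, hl⟩ := h'; exact hu.2 hl.1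
      · obtain ⟨-, rfl, hl⟩ := h'; exact hu.2 hl.1
    obtain ⟨⟨huv, -⟩, ⟨hwv, -⟩, hne', huw⟩ := hvs
    by_cases huw' : Adjacent G' u w
    · have hu : (u = x ∧ w = y) ∨ (w = x ∧ u = y) := ((hG'adj u w).1 huw').resolve_left huw
      have hxv : G.Adj x v := by rcases hu with ⟨rfl, rfl⟩ | ⟨rfl, rfl⟩ <;> assumption
      have hyv : G.Adj y v := by rcases hu with ⟨rfl, rfl⟩ | ⟨rfl, rfl⟩ <;> assumption
      have hxyu : u = x ∨ u = y := hu.imp And.left And.right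
      by_cases hvT : v ∈ T
      · have hl : Line C u v → Arrow (deletePDAG C x y T) u v := by
          intro hl
          have hn := (hGadj u v).1 (Or.inl huv)
          refine ⟨(hP _ _).2 ⟨hl.1, hn.2.1, fun h' => hn.2.2 h'.symm, fun h' => ?_, fun h' => ?_⟩,
            fun h' => ?_⟩
          · obtain ⟨-, rfl, -⟩ := h'; exact hxT hvT
          · obtain ⟨-, rfl, -⟩ := h'; exact hyT hvT
          · obtain ⟨-, -, -, h₁, h₂⟩ := (hP _ _).1 h'
            rcases hxyu with rfl | rfl
            · exact h₁ ⟨hvT, rfl, hl⟩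
            · exact h₂ ⟨hvT, rfl, hl⟩
        exact (hG'.arrow_or_line (hle huv)).elim (key huv) hl
      -- For `v ∉ T` the CPDAG already has `y → v`. If it had `x - v` undirected,
      -- `Arrow.of_line_cpdagOf` would give `y → x`, contrary to `x → y`. Here the completeness of
      -- Meek's rules is needed.
      · have hayv : Arrow C y v := (hG'.arrow_or_line (hle hyv)).resolve_right fun hl =>
          hvT ⟨hl, hCadj.2 (Or.inl (hle hxv)), hle hyv⟩
        rcases hxyu with rfl | rfl
        · refine key huv ((hG'.arrow_or_line (hle huv)).resolve_right fun hl => ?_)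
          exact hG'.asymm hxy' (Arrow.adj_of_cpdagOf hG'
            (hayv.of_line_cpdagOf hG' ⟨hl.2, hl.1⟩))
        · exact key huv hayv
    · exact key huv ((hG'.isVStructure (hle huv) (hle hwv) hne' huw').arrow_cpdagOf hG')

end Graphs

/-! ### Insert and Delete moves are inverse to each other. -/

theorem Represents.adjacent {V : Type*} {C D : Digraph V} (h : Represents C D) {x y : V} :
    Adjacent C x y ↔ Adjacent D x y := by
  rw [← h.2]; exact h.1.adjacent_cpdagOf

theorem IsEdgeInsertion.adjacent {V : Type*} {G G' : Digraph V} (h : IsEdgeInsertion G G')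
    {u v : V} (huv : Adjacent G u v) : Adjacent G' u v := by
  obtain ⟨x, y, -, h⟩ := h
  exact huv.imp (fun h' => (h _ _).2 (Or.inl h')) fun h' => (h _ _).2 (Or.inl h')

/-- An Insert operator joins two vertices that are not adjacent in `γ`, whereas an edge deletion
creates no adjacency; so its local move is an edge insertion. The converse is
`exists_isInsertResult`. -/
theorem mem_insertSet_iff {n : ℕ} {γ η : CPDAG n} : η ∈ insertSet γ ↔
    ∃ G G', Represents γ.1 G ∧ Represents η.1 G' ∧ IsEdgeInsertion G G' := by
  constructor
  · rintro ⟨⟨G, G', hG, hG', h | h⟩, x, y, T, -, hna, -, D, hDP, hD⟩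
    · exact ⟨G, G', hG, hG', h⟩
    · have h1 : Adjacent η.1 x y :=
        hD.adjacent.2 ((hDP.1 x y).2 (Or.inl (Or.inl ⟨rfl, rfl⟩)))
      exact absurd (hG.adjacent.2 (h.adjacent (hG'.adjacent.1 h1))) hna
  · rintro ⟨G, G', hG, hG', h⟩
    refine ⟨⟨G, G', hG, hG', Or.inl h⟩, ?_⟩
    rw [← hG.2, ← hG'.2]
    exact exists_isInsertResult hG.1 hG'.1 h

theorem mem_deleteSet_iff {n : ℕ} {γ η : CPDAG n} : γ ∈ deleteSet η ↔
    ∃ G G', Represents γ.1 G ∧ Represents η.1 G' ∧ IsEdgeInsertion G G' := by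
  constructor
  · rintro ⟨⟨G', G, hG', hG, h | h⟩, x, y, T, hxy, hT, D, hDP, hD⟩
    · have h1 : Adjacent γ.1 x y := hG.adjacent.2 (h.adjacent (hG'.adjacent.1
        (hxy.elim (fun h => Or.inl h.1) fun h => Or.inl h.1)))
      rcases (hDP.1 x y).1 (hD.adjacent.1 h1) with h | h
      · exact absurd ⟨rfl, rfl⟩ h.2.1
      · exact absurd ⟨rfl, rfl⟩ h.2.2.1
    · exact ⟨G, G', hG, hG', h⟩
  · rintro ⟨G, G', hG, hG', h⟩
    refine ⟨⟨G', G, hG', hG, Or.inr h⟩, ?_⟩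
    rw [← hG.2, ← hG'.2]
    exact exists_isDeleteResult hG.1 hG'.1 h

theorem mem_deleteSet_iff_mem_insertSet {n : ℕ} {γ η : CPDAG n} :
    γ ∈ deleteSet η ↔ η ∈ insertSet γ := mem_deleteSet_iff.trans mem_insertSet_iff.symm

/-! ### Insert paths from the empty to the complete CPDAG. -/

section Reachability

variable {n : ℕ}

/-- The CPDAG of a DAG. -/
def toCPDAG (G : Digraph (Fin n)) (hG : IsDAG G) : CPDAG n := ⟨cpdagOf G, G, hG, rfl⟩

theorem exists_toCPDAG (γ : CPDAG n) : ∃ G hG, toCPDAG G hG = γ := by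
  obtain ⟨G, hG, h⟩ := γ.2
  exact ⟨G, hG, Subtype.ext h⟩

theorem isDAG_bot : IsDAG (⊥ : Digraph (Fin n)) := fun x h => by
  obtain ⟨y, h, -⟩ := Relation.TransGen.head'_iff.1 h
  exact h

/-- All graphs between `G` and `G'` are acyclic as subgraphs of `G'`, so the missing edges can be
inserted in any order. -/
theorem exists_insert_path {G G' : Digraph (Fin n)} (hG : IsDAG G) (hG' : IsDAG G')
    (h : ∀ x y, G.Adj x y → G'.Adj x y) :
    Relation.ReflTransGen (fun γ η => η ∈ insertSet γ) (toCPDAG G hG) (toCPDAG G' hG') := by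
  induction hm : {p : Fin n × Fin n | G'.Adj p.1 p.2 ∧ ¬ G.Adj p.1 p.2}.ncard generalizing G with
  | zero =>
    rw [Set.ncard_eq_zero (Set.toFinite _)] at hm
    have : G = G' := by
      ext x y
      refine ⟨h x y, fun h' => ?_⟩
      by_contra hn
      have : (x, y) ∈ (∅ : Set (Fin n × Fin n)) := hm ▸ ⟨h', hn⟩
      exact this
    subst this
    exact .refl
  | succ m ih =>
    obtain ⟨⟨x, y⟩, hxy', hxy⟩ := Set.nonempty_of_ncard_ne_zero (by omega :
      {p : Fin n × Fin n | G'.Adj p.1 p.2 ∧ ¬ G.Adj p.1 p.2}.ncard ≠ 0)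
    simp only at hxy' hxy
    set G₁ : Digraph (Fin n) := ⟨fun u v => G.Adj u v ∨ (u = x ∧ v = y)⟩ with hG₁
    have hle : ∀ u v, G₁.Adj u v → G'.Adj u v := by
      rintro u v (huv | ⟨rfl, rfl⟩)
      · exact h u v huv
      · exact hxy'
    have hdag : IsDAG G₁ := hG'.mono hle
    refine Relation.ReflTransGen.head (b := toCPDAG G₁ hdag) ?_ (ih hdag hle ?_)
    · exact mem_insertSet_iff.2 ⟨G, G₁, ⟨hG, rfl⟩, ⟨hdag, rfl⟩, x, y, hxy, fun u v => Iff.rfl⟩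
    · have hset : {p : Fin n × Fin n | G'.Adj p.1 p.2 ∧ ¬ G₁.Adj p.1 p.2} =
          {p : Fin n × Fin n | G'.Adj p.1 p.2 ∧ ¬ G.Adj p.1 p.2} \ {(x, y)} := by
        ext ⟨u, v⟩
        simp only [hG₁, Set.mem_ofPred_eq, Set.mem_sdiff, Set.mem_singleton_iff, Prod.mk.injEq]
        tauto
      rw [hset, Set.ncard_sdiff_singleton_of_mem (Set.mem_ofPred_eq.symm ▸ ⟨hxy', hxy⟩), hm]
      rfl

/-- The complete DAG along a linear order. -/
def completeDAG {α : Type*} [LinearOrder α] (f : Fin n → α) : Digraph (Fin n) where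
  Adj x y := f x < f y

theorem isDAG_completeDAG {α : Type*} [LinearOrder α] (f : Fin n → α) :
    IsDAG (completeDAG f) := by
  have : ∀ x y, Relation.TransGen (completeDAG f).Adj x y → f x < f y := by
    intro x y h
    induction h with
    | single h => exact h
    | tail _ h ih => exact ih.trans h
  exact fun x hx => lt_irrefl _ (this x x hx)

theorem adjacent_completeDAG {α : Type*} [LinearOrder α] {f : Fin n → α}
    (hf : Function.Injective f) {x y : Fin n} : Adjacent (completeDAG f) x y ↔ x ≠ y := by
  constructor
  · rintro h rfl
    exact h.elim (lt_irrefl _) (lt_irrefl _)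
  · intro h
    exact lt_or_gt_of_ne (hf.ne h)

theorem samePattern_completeDAG {α β : Type*} [LinearOrder α] [LinearOrder β] {f : Fin n → α}
    (hf : Function.Injective f) {g : Fin n → β} (hg : Function.Injective g) :
    SamePattern (completeDAG f) (completeDAG g) :=
  ⟨fun x y => by rw [adjacent_completeDAG hf, adjacent_completeDAG hg], fun x y z =>
    ⟨fun h => absurd ((adjacent_completeDAG hf).2 h.2.2.1) h.2.2.2,
      fun h => absurd ((adjacent_completeDAG hg).2 h.2.2.1) h.2.2.2⟩⟩

variable (n) in
/-- The CPDAG without edges. -/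
def emptyCPDAG : CPDAG n := toCPDAG ⊥ isDAG_bot

variable (n) in
/-- The CPDAG in which all vertices are adjacent. -/
def completeCPDAG : CPDAG n := toCPDAG (completeDAG id) (isDAG_completeDAG id)

theorem insert_path_from_empty (γ : CPDAG n) :
    Relation.ReflTransGen (fun γ η => η ∈ insertSet γ) (emptyCPDAG n) γ := by
  obtain ⟨G, hG, rfl⟩ := exists_toCPDAG γ
  exact exists_insert_path isDAG_bot hG fun _ _ h => h.elim

theorem insert_path_to_complete (γ : CPDAG n) :
    Relation.ReflTransGen (fun γ η => η ∈ insertSet γ) γ (completeCPDAG n) := by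
  obtain ⟨G, hG, rfl⟩ := exists_toCPDAG γ
  obtain ⟨σ, hσ⟩ := hG.exists_topologicalOrder
  -- A topological order need not be injective; ties are broken by the vertex label.
  set f : Fin n → ℤ ×ₗ Fin n := fun x => toLex (σ x, x) with hf
  have hinj : Function.Injective f := fun x y h => by
    have := congrArg (fun p => (ofLex p).2) h
    simpa [hf] using this
  have heq : toCPDAG (completeDAG f) (isDAG_completeDAG f) = completeCPDAG n :=
    Subtype.ext (cpdagOf_eq_of_samePattern (samePattern_completeDAG hinj Function.injective_id))
  rw [← heq]
  exact exists_insert_path hG _ fun x y h => Prod.Lex.toLex_lt_toLex.2 (Or.inl (hσ x y h))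

theorem adjacent_emptyCPDAG {x y : Fin n} : ¬ Adjacent (emptyCPDAG n).1 x y := fun h =>
  (isDAG_bot.adjacent_cpdagOf.1 h).elim id id

theorem adjacent_completeCPDAG {x y : Fin n} : Adjacent (completeCPDAG n).1 x y ↔ x ≠ y :=
  (isDAG_completeDAG id).adjacent_cpdagOf.trans (adjacent_completeDAG Function.injective_id)

theorem emptyCPDAG_ne_completeCPDAG (hn : 2 ≤ n) : emptyCPDAG n ≠ completeCPDAG n := fun h => by
  have : Adjacent (completeCPDAG n).1 (⟨0, by omega⟩ : Fin n) ⟨1, by omega⟩ :=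
    adjacent_completeCPDAG.2 (by simp)
  rw [← h] at this
  exact adjacent_emptyCPDAG this

theorem exists_of_mem_insertSet {γ η : CPDAG n} (h : η ∈ insertSet γ) :
    ∃ x y, x ≠ y ∧ ¬ Adjacent γ.1 x y ∧ Adjacent η.1 x y := by
  obtain ⟨G, G', hG, hG', x, y, hxy, h⟩ := mem_insertSet_iff.1 h
  have hxy' : G'.Adj x y := (h x y).2 (Or.inr ⟨rfl, rfl⟩)
  refine ⟨x, y, hG'.1.ne hxy', fun h' => ?_, hG'.adjacent.2 (Or.inl hxy')⟩
  exact (hG.adjacent.1 h').elim hxy fun h' => hG'.1.asymm hxy' ((h _ _).2 (Or.inl h'))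

theorem insertSet_completeCPDAG {η : CPDAG n} : η ∉ insertSet (completeCPDAG n) := fun h => by
  obtain ⟨x, y, hne, h, -⟩ := exists_of_mem_insertSet h
  exact h (adjacent_completeCPDAG.2 hne)

theorem deleteSet_emptyCPDAG {η : CPDAG n} : η ∉ deleteSet (emptyCPDAG n) := fun h => by
  obtain ⟨x, y, -, -, h⟩ := exists_of_mem_insertSet (mem_deleteSet_iff_mem_insertSet.1 h)
  exact adjacent_emptyCPDAG h

/-- Makes the flip rate at the empty CPDAG positive; with a single vertex there would be no move at
all. -/
theorem exists_mem_insertSet_emptyCPDAG (hn : 2 ≤ n) : ∃ η, η ∈ insertSet (emptyCPDAG n) := by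
  rcases (insert_path_from_empty (completeCPDAG n)).cases_head with h | ⟨η, h, -⟩
  · exact absurd h (emptyCPDAG_ne_completeCPDAG hn)
  · exact ⟨η, h⟩

theorem exists_mem_deleteSet_completeCPDAG (hn : 2 ≤ n) :
    ∃ η, η ∈ deleteSet (completeCPDAG n) := by
  rcases (insert_path_from_empty (completeCPDAG n)).cases_tail with h | ⟨η, -, h⟩
  · exact absurd h.symm (emptyCPDAG_ne_completeCPDAG hn)
  · exact ⟨η, mem_deleteSet_iff_mem_insertSet.2 h⟩

theorem notMem_insertSet_self {γ : CPDAG n} : γ ∉ insertSet γ := fun h => by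
  obtain ⟨x, y, -, h, h'⟩ := exists_of_mem_insertSet h
  exact h h'

end Reachability

/-! ### Balance equation and irreducibility of the rates. -/

section Rates

variable {n : ℕ} {g : ℝ≥0 → ℝ≥0} {π : CPDAG n → ℝ≥0}

theorem moveRate_one (γ η : CPDAG n) [Decidable (η ∈ insertSet γ)] :
    moveRate g π 1 γ η = if η ∈ insertSet γ then g (π η / π γ) else 0 := by
  have : (1 : ℤˣ) ≠ -1 := by decide
  simp [moveRate, this]

theorem moveRate_neg_one (γ η : CPDAG n) [Decidable (η ∈ deleteSet γ)] :
    moveRate g π (-1) γ η = if η ∈ deleteSet γ then g (π η / π γ) else 0 := by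
  have : (-1 : ℤˣ) ≠ 1 := by decide
  simp [moveRate, this]

/-- Detailed balance between Insert and Delete moves. -/
theorem mul_moveRate (hg : IsBalancing g) (hπ : ∀ γ, 0 < π γ) (d : ℤˣ) (γ η : CPDAG n) :
    π η * moveRate g π d η γ = π γ * moveRate g π (-d) γ η := by
  classical
  have key : ∀ γ η : CPDAG n, π η * g (π γ / π η) = π γ * g (π η / π γ) := by
    intro γ η
    have hγ := (hπ γ).ne'
    have hη := (hπ η).ne'
    rw [hg.balance (π γ / π η) (div_pos (hπ γ) (hπ η)), one_div_div, ← mul_assoc,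
      mul_div_cancel₀ _ hη]
  rcases Int.units_eq_one_or d with rfl | rfl
  · rw [moveRate_one, moveRate_neg_one]
    simp only [← mem_deleteSet_iff_mem_insertSet (γ := η) (η := γ)]
    split_ifs
    · exact key γ η
    · simp
  · rw [neg_neg, moveRate_one, moveRate_neg_one]
    simp only [mem_deleteSet_iff_mem_insertSet (γ := γ) (η := η)]
    split_ifs
    · exact key γ η
    · simp

theorem zigZagRate_same (d : ℤˣ) (γ η : CPDAG n) :
    zigZagRate g π (γ, d) (η, d) = moveRate g π d γ η := by simp [zigZagRate]

theorem units_neg_ne (d : ℤˣ) : -d ≠ d := by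
  rcases Int.units_eq_one_or d with rfl | rfl <;> decide

theorem zigZagRate_neg (d : ℤˣ) (γ η : CPDAG n) [Decidable (η = γ)] :
    zigZagRate g π (γ, d) (η, -d) = if η = γ then flipRate g π d γ else 0 := by
  simp [zigZagRate]

theorem zigZagRate_self (a : State n) : zigZagRate g π a a = 0 := by
  classical
  obtain ⟨γ, d⟩ := a
  rw [zigZagRate_same]
  rcases Int.units_eq_one_or d with rfl | rfl
  · rw [moveRate_one, if_neg notMem_insertSet_self]
  · rw [moveRate_neg_one, if_neg fun h =>
      notMem_insertSet_self (mem_deleteSet_iff_mem_insertSet.1 h)]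

theorem sum_state {M : Type*} [AddCommMonoid M] (d : ℤˣ) (f : State n → M) :
    ∑ a, f a = ∑ γ, f (γ, d) + ∑ γ, f (γ, -d) := by
  rw [Fintype.sum_prod_type, ← Finset.sum_add_distrib]
  refine Finset.sum_congr rfl fun γ _ => ?_
  rcases Int.units_eq_one_or d with rfl | rfl
  · simp
  · simp [add_comm]

/-- The distribution `π{γ} / 2` solves the equilibrium equations of the rates. -/
theorem sum_mul_zigZagRate (hg : IsBalancing g) (hπ : ∀ γ, 0 < π γ) (b : State n) :
    ∑ a, (π a.1 : ℝ) * zigZagRate g π a b = π b.1 * totalRate (zigZagRate g π) b := by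
  classical
  obtain ⟨γ, d⟩ := b
  rw [totalRate, sum_state d, sum_state d]
  simp only [zigZagRate_same, zigZagRate_neg]
  have h₁ : ∀ η, (zigZagRate g π (η, -d) (γ, d) : ℝ) =
      if η = γ then (flipRate g π (-d) γ : ℝ) else 0 := by
    intro η
    have := zigZagRate_neg (g := g) (π := π) (-d) η γ
    rw [neg_neg] at this
    rw [this]
    by_cases h : γ = η
    · subst h; simp
    · simp [h, Ne.symm h]
  have h₂ : ∀ η, (π η : ℝ) * moveRate g π d η γ = π γ * moveRate g π (-d) γ η := fun η => by
    exact_mod_cast mul_moveRate hg hπ d γ η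
  simp only [h₁, h₂, mul_ite, mul_zero, Finset.sum_ite_eq', Finset.mem_univ, if_true,
    ← Finset.mul_sum]
  rw [← mul_add]
  congr 1
  push_cast
  simp only [flipRate, neg_neg, Real.coe_toNNReal']
  -- It remains to check `B + (A - B)⁺ = A + (B - A)⁺`; both sides are the maximum of `A` and `B`.
  generalize ∑ η, (moveRate g π d γ η : ℝ) = A
  generalize ∑ η, (moveRate g π (-d) γ η : ℝ) = B
  rcases le_total A B with h | h
  · rw [max_eq_right (by linarith : -B + A ≤ 0), max_eq_left (by linarith : 0 ≤ -A + B)]; ring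
  · rw [max_eq_left (by linarith : 0 ≤ -B + A), max_eq_right (by linarith : -A + B ≤ 0)]; ring

/-- Meant for the complete CPDAG in direction `+1` and the empty one in direction `-1`, where no
move is left. -/
theorem flipRate_pos {γ η : CPDAG n} {d : ℤˣ} (h : ∀ η, moveRate g π d γ η = 0)
    (h' : 0 < moveRate g π (-d) γ η) : 0 < flipRate g π d γ := by
  rw [flipRate, Real.toNNReal_pos]
  simp only [h, NNReal.coe_zero, Finset.sum_const_zero, neg_zero, zero_add]
  exact Finset.sum_pos' (fun _ _ => NNReal.coe_nonneg _) ⟨η, Finset.mem_univ _, h'⟩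

/-- Any state leads to any other one through transitions with positive rates. -/
theorem zigZagRate_irreducible (hn : 2 ≤ n) (hg : IsBalancing g) (hπ : ∀ γ, 0 < π γ)
    (a b : State n) : Relation.ReflTransGen (fun a b => 0 < zigZagRate g π a b) a b := by
  classical
  set R : State n → State n → Prop := fun a b => 0 < zigZagRate g π a b
  have hgpos : ∀ γ η : CPDAG n, 0 < g (π η / π γ) := fun γ η => hg.pos _ (div_pos (hπ η) (hπ γ))
  have hup : ∀ {γ η}, Relation.ReflTransGen (fun γ η => η ∈ insertSet γ) γ η →
      Relation.ReflTransGen R (γ, 1) (η, 1) := by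
    intro γ η h
    refine h.lift (fun γ => ((γ, 1) : State n)) fun γ η h => ?_
    change 0 < zigZagRate g π (γ, 1) (η, 1)
    rw [zigZagRate_same, moveRate_one, if_pos h]
    exact hgpos γ η
  have hdown : ∀ {γ η}, Relation.ReflTransGen (fun γ η => η ∈ insertSet γ) γ η →
      Relation.ReflTransGen R (η, -1) (γ, -1) := by
    intro γ η h
    refine Relation.ReflTransGen.lift (r := fun η γ => η ∈ insertSet γ)
      (fun γ => ((γ, -1) : State n)) (fun η γ h => ?_) _ _ h.swap
    change 0 < zigZagRate g π (η, -1) (γ, -1)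
    rw [zigZagRate_same, moveRate_neg_one, if_pos (mem_deleteSet_iff_mem_insertSet.2 h)]
    exact hgpos η γ
  have htop : R (completeCPDAG n, 1) (completeCPDAG n, -1) := by
    obtain ⟨η, hη⟩ := exists_mem_deleteSet_completeCPDAG hn
    change 0 < zigZagRate g π _ _
    rw [zigZagRate_neg, if_pos rfl]
    refine flipRate_pos (η := η) (fun η => ?_) ?_
    · rw [moveRate_one, if_neg insertSet_completeCPDAG]
    · rw [moveRate_neg_one, if_pos hη]
      exact hgpos _ _
  have hbot : R (emptyCPDAG n, -1) (emptyCPDAG n, 1) := by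
    obtain ⟨η, hη⟩ := exists_mem_insertSet_emptyCPDAG hn
    have := zigZagRate_neg (g := g) (π := π) (-1) (emptyCPDAG n) (emptyCPDAG n)
    rw [neg_neg] at this
    change 0 < zigZagRate g π _ _
    rw [this, if_pos rfl]
    refine flipRate_pos (η := η) (fun η => ?_) ?_
    · rw [moveRate_neg_one, if_neg deleteSet_emptyCPDAG]
    · rw [neg_neg, moveRate_one, if_pos hη]
      exact hgpos _ _
  -- Flip at the top, delete all edges, flip at the bottom.
  have hcore : Relation.ReflTransGen R
      (completeCPDAG n, 1) (emptyCPDAG n, 1) :=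
    ((hdown (insert_path_from_empty (completeCPDAG n))).head htop).tail hbot
  have hcore' : Relation.ReflTransGen R
      (emptyCPDAG n, -1) (completeCPDAG n, -1) :=
    ((hup (insert_path_from_empty (completeCPDAG n))).head hbot).tail htop
  obtain ⟨γ, d⟩ := a
  obtain ⟨η, e⟩ := b
  have hfrom : Relation.ReflTransGen R (γ, d)
      (emptyCPDAG n, 1) := by
    rcases Int.units_eq_one_or d with rfl | rfl
    · exact (hup (insert_path_to_complete γ)).trans hcore
    · exact (hdown (insert_path_from_empty γ)).tail hbot
  refine hfrom.trans ?_
  rcases Int.units_eq_one_or e with rfl | rfl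
  · exact hup (insert_path_from_empty η)
  · exact ((hup (insert_path_to_complete _)).tail htop).trans
      (hdown (insert_path_to_complete η))

theorem totalRate_zigZagRate_pos (hn : 2 ≤ n) (hg : IsBalancing g) (hπ : ∀ γ, 0 < π γ)
    (a : State n) : 0 < totalRate (zigZagRate g π) a := by
  obtain ⟨γ, d⟩ := a
  rcases (zigZagRate_irreducible hn hg hπ (γ, d) (γ, -d)).cases_head with h | ⟨b, h, -⟩
  · exact absurd (congrArg Prod.snd h).symm (units_neg_ne d)
  · exact Finset.sum_pos' (fun _ _ => zero_le) ⟨b, Finset.mem_univ _, h⟩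

end Rates

/-! ### The transition semigroup as an exponential series with nonnegative terms (uniformization).
-/

section Semigroup

variable {S : Type*} [Fintype S] (rate : S → S → ℝ≥0)

/-- The generator of a jump process with the given rates, acting on distributions. -/
noncomputable def generator : (S → ℝ) →L[ℝ] (S → ℝ) :=
  LinearMap.toContinuousLinearMap
    { toFun := fun v b => ∑ a, v a * rate a b - v b * totalRate rate b
      map_add' := fun v w => by
        ext b
        simp only [Pi.add_apply, add_mul, Finset.sum_add_distrib]
        ring
      map_smul' := fun c v => by
        ext b
        simp only [Pi.smul_apply, smul_eq_mul, RingHom.id_apply, mul_assoc, ← Finset.mul_sum]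
        ring }

theorem generator_apply (v : S → ℝ) (b : S) :
    generator rate v b = ∑ a, v a * rate a b - v b * totalRate rate b := rfl

/-- An upper bound of all total rates. -/
noncomputable def rateBound : ℝ := ∑ a, (totalRate rate a : ℝ)

theorem totalRate_le_rateBound (a : S) : (totalRate rate a : ℝ) ≤ rateBound rate :=
  Finset.single_le_sum (f := fun a => (totalRate rate a : ℝ)) (fun _ _ => NNReal.coe_nonneg _)
    (Finset.mem_univ a)

/-- The generator, made positive by a multiple of the identity. -/
noncomputable def shiftedGenerator : (S → ℝ) →L[ℝ] (S → ℝ) :=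
  generator rate + rateBound rate • 1

theorem shiftedGenerator_apply (v : S → ℝ) (b : S) : shiftedGenerator rate v b =
    ∑ a, v a * rate a b + (rateBound rate - totalRate rate b) * v b := by
  simp only [shiftedGenerator, _root_.add_apply, _root_.smul_apply,
    one_apply_eq_self, Pi.add_apply, Pi.smul_apply, smul_eq_mul, generator_apply]
  ring

/-- The transition semigroup with the given rates, acting on distributions. -/
noncomputable def semigroup (t : ℝ) : (S → ℝ) →L[ℝ] (S → ℝ) :=
  Real.exp (-(rateBound rate * t)) • NormedSpace.exp (t • shiftedGenerator rate)

theorem semigroup_zero : semigroup rate 0 = 1 := by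
  simp [semigroup, NormedSpace.exp_zero]

theorem hasDerivAt_semigroup (t : ℝ) :
    HasDerivAt (semigroup rate) (semigroup rate t * generator rate) t := by
  have h₁ : HasDerivAt (fun t : ℝ => Real.exp (-(rateBound rate * t)))
      (Real.exp (-(rateBound rate * t)) * -(rateBound rate * 1)) t :=
    (((hasDerivAt_id t).const_mul (rateBound rate)).neg).exp
  have h₂ := hasDerivAt_exp_smul_const (𝕂 := ℝ) (shiftedGenerator rate) t
  refine (h₁.smul h₂).congr_deriv ?_
  have : generator rate = shiftedGenerator rate - rateBound rate • 1 := by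
    simp [shiftedGenerator]
  rw [this, semigroup, mul_sub, smul_mul_assoc, mul_smul_comm, mul_one, mul_one, smul_smul, sub_eq_add_neg,
    mul_neg, mul_comm (rateBound rate) (Real.exp _)]
  exact congrArg _ (neg_smul _ _)

theorem hasSum_semigroup (t : ℝ) (v : S → ℝ) (b : S) :
    HasSum (fun k : ℕ => Real.exp (-(rateBound rate * t)) *
      ((k.factorial : ℝ)⁻¹ * (t ^ k * (shiftedGenerator rate ^ k) v b))) (semigroup rate t v b) := by
  have h := NormedSpace.exp_series_hasSum_exp' (𝕂 := ℝ) (t • shiftedGenerator rate)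
  have h' := h.mapL ((ContinuousLinearMap.proj (R := ℝ) (φ := fun _ : S => ℝ) b).comp
    (ContinuousLinearMap.apply ℝ (S → ℝ) v))
  refine Eq.mp (congrArg (HasSum · _) (funext fun k => ?_)) (h'.mul_left (Real.exp (-(rateBound rate * t))))
  simp [smul_pow]

theorem shiftedGenerator_nonneg {v : S → ℝ} (hv : ∀ a, 0 ≤ v a) (b : S) :
    0 ≤ shiftedGenerator rate v b := by
  rw [shiftedGenerator_apply]
  exact add_nonneg (Finset.sum_nonneg fun a _ => mul_nonneg (hv a) (NNReal.coe_nonneg _))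
    (mul_nonneg (sub_nonneg.2 (totalRate_le_rateBound rate b)) (hv b))

theorem shiftedGenerator_pow_nonneg {v : S → ℝ} (hv : ∀ a, 0 ≤ v a) (k : ℕ) :
    ∀ b, 0 ≤ (shiftedGenerator rate ^ k) v b := by
  induction k with
  | zero => simpa using hv
  | succ k ih =>
    intro b
    rw [pow_succ']
    exact shiftedGenerator_nonneg rate ih b

/-- The length of a path with positive rates is a suitable exponent, because the shifted generator
has nonnegative entries and nothing cancels. -/
theorem exists_shiftedGenerator_pow_pos {v : S → ℝ} (hv : ∀ a, 0 ≤ v a) {a b : S} (ha : 0 < v a)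
    (h : Relation.ReflTransGen (fun a b => 0 < rate a b) a b) :
    ∃ k, 0 < (shiftedGenerator rate ^ k) v b := by
  induction h with
  | refl => exact ⟨0, by simpa using ha⟩
  | @tail b c _ hbc ih =>
    obtain ⟨k, hk⟩ := ih
    refine ⟨k + 1, ?_⟩
    have hn := shiftedGenerator_pow_nonneg rate hv k
    rw [pow_succ']
    change 0 < shiftedGenerator rate ((shiftedGenerator rate ^ k) v) c
    rw [shiftedGenerator_apply]
    refine add_pos_of_pos_of_nonneg (Finset.sum_pos' (fun a _ => mul_nonneg (hn a)
      (NNReal.coe_nonneg _)) ⟨b, Finset.mem_univ _, mul_pos hk hbc⟩)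
      (mul_nonneg (sub_nonneg.2 (totalRate_le_rateBound rate c)) (hn c))

theorem semigroup_nonneg {t : ℝ} (ht : 0 ≤ t) {v : S → ℝ} (hv : ∀ a, 0 ≤ v a) (b : S) :
    0 ≤ semigroup rate t v b :=
  (hasSum_semigroup rate t v b).nonneg fun k => mul_nonneg (Real.exp_pos _).le
    (mul_nonneg (by positivity)
      (mul_nonneg (pow_nonneg ht k) (shiftedGenerator_pow_nonneg rate hv k b)))

/-- One positive term of the series suffices, as the others are nonnegative. It is positive at every
`t > 0`, so periodicity is no issue. -/
theorem semigroup_pos (hirr : ∀ a b, Relation.ReflTransGen (fun a b => 0 < rate a b) a b)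
    {t : ℝ} (ht : 0 < t) {v : S → ℝ} (hv : ∀ a, 0 ≤ v a) {a : S} (ha : 0 < v a) (b : S) :
    0 < semigroup rate t v b := by
  obtain ⟨k, hk⟩ := exists_shiftedGenerator_pow_pos rate hv ha (hirr a b)
  have h := hasSum_semigroup rate t v b
  refine lt_of_lt_of_le ?_ (le_hasSum h k fun j _ => ?_)
  · positivity
  · exact mul_nonneg (Real.exp_pos _).le (mul_nonneg (by positivity)
      (mul_nonneg (pow_nonneg ht.le j) (shiftedGenerator_pow_nonneg rate hv j b)))

theorem sum_shiftedGenerator (v : S → ℝ) :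
    ∑ b, shiftedGenerator rate v b = rateBound rate * ∑ b, v b := by
  simp only [shiftedGenerator_apply, Finset.sum_add_distrib, sub_mul, Finset.sum_sub_distrib,
    Finset.mul_sum]
  rw [Finset.sum_comm]
  simp only [← Finset.mul_sum, totalRate, NNReal.coe_sum]
  simp only [mul_comm (v _)]
  ring

/-- The generator conserves mass, so the shifted one multiplies it by `rateBound`; the resulting
exponential cancels the scalar prefactor of `semigroup`. -/
theorem sum_semigroup (t : ℝ) (v : S → ℝ) : ∑ b, semigroup rate t v b = ∑ b, v b := by
  have hpow : ∀ k, ∑ b, (shiftedGenerator rate ^ k) v b = rateBound rate ^ k * ∑ b, v b := by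
    intro k
    induction k with
    | zero => simp
    | succ k ih =>
      rw [pow_succ', pow_succ', mul_assoc, ← ih]
      exact sum_shiftedGenerator rate _
  have h := hasSum_sum (s := Finset.univ) fun b _ => hasSum_semigroup rate t v b
  simp only [← Finset.mul_sum, hpow] at h
  refine h.unique ?_
  have h' := (NormedSpace.exp_series_hasSum_exp' (𝕂 := ℝ) (rateBound rate * t)).mul_right
    (Real.exp (-(rateBound rate * t)) * ∑ b, v b)
  rw [← Real.exp_eq_exp_ℝ, ← mul_assoc, ← Real.exp_add, add_neg_cancel, Real.exp_zero,
    one_mul] at h'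
  refine Eq.mp (congrArg (HasSum · _) (funext fun k => ?_)) h'
  simp only [smul_eq_mul, mul_pow]
  ring

/-! ### Solutions of the forward equation: uniqueness and contraction. -/

/-- A curve of vectors that follows the forward equation of the rates up to a quadratic error. -/
structure IsFlow (f : ℝ≥0 → S → ℝ) : Prop where
  bounded : ∃ M, ∀ t, ‖f t‖ ≤ M
  approx : ∃ C : ℝ, ∀ t h : ℝ≥0, h ≤ 1 →
    ‖f (t + h) - f t - (h : ℝ) • generator rate (f t)‖ ≤ C * (h : ℝ) ^ 2

variable {rate}

theorem IsFlow.shift {f : ℝ≥0 → S → ℝ} (hf : IsFlow rate f) (s : ℝ≥0) :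
    IsFlow rate fun t => f (s + t) := by
  obtain ⟨⟨M, hM⟩, C, hC⟩ := hf
  exact ⟨⟨M, fun t => hM _⟩, C, fun t h hh => by simpa only [add_assoc] using hC (s + t) h hh⟩

theorem IsFlow.exists_lipschitz {f : ℝ≥0 → S → ℝ} (hf : IsFlow rate f) :
    ∃ K : ℝ, ∀ t h : ℝ≥0, h ≤ 1 → ‖f (t + h) - f t‖ ≤ K * h := by
  obtain ⟨⟨M, hM⟩, C, hC⟩ := hf
  have hC0 : 0 ≤ C := by simpa using (norm_nonneg _).trans (hC 0 1 le_rfl)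
  refine ⟨C + ‖generator rate‖ * M, fun t h hh => ?_⟩
  have hh' : (h : ℝ) ≤ 1 := hh
  have h0 : (0 : ℝ) ≤ h := h.2
  calc ‖f (t + h) - f t‖
      = ‖(f (t + h) - f t - (h : ℝ) • generator rate (f t)) + (h : ℝ) • generator rate (f t)‖ := by
        rw [sub_add_cancel]
    _ ≤ C * (h : ℝ) ^ 2 + h * (‖generator rate‖ * M) := by
        refine (norm_add_le _ _).trans (add_le_add (hC t h hh) ?_)
        rw [norm_smul, Real.norm_of_nonneg h0]
        gcongr
        exact ((generator rate).le_opNorm _).trans (by gcongr; exact hM t)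
    _ ≤ (C + ‖generator rate‖ * M) * h := by nlinarith [mul_nonneg hC0 h0]

theorem IsFlow.continuous {f : ℝ≥0 → S → ℝ} (hf : IsFlow rate f) : Continuous f := by
  obtain ⟨K, hK⟩ := hf.exists_lipschitz
  have hK0 : 0 ≤ K := by simpa using (norm_nonneg _).trans (hK 0 1 le_rfl)
  have key : ∀ s t : ℝ≥0, s ≤ t → dist s t ≤ 1 → dist (f s) (f t) ≤ K * dist s t := by
    intro s t hst hd
    obtain ⟨h, rfl⟩ := exists_add_of_le hst
    have hd' : dist s (s + h) = h := by
      rw [dist_comm, NNReal.dist_eq]; simp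
    rw [hd'] at hd ⊢
    rw [dist_comm, dist_eq_norm]
    exact hK s h hd
  have key' : ∀ s t : ℝ≥0, dist s t ≤ 1 → dist (f s) (f t) ≤ K * dist s t := by
    intro s t hd
    rcases le_total s t with h | h
    · exact key s t h hd
    · rw [dist_comm, dist_comm s t]
      exact key t s h (by rwa [dist_comm])
  rw [continuous_iff_continuousAt]
  intro t
  rw [Metric.continuousAt_iff]
  intro ε hε
  refine ⟨min 1 (ε / (K + 1)), by positivity, fun {s} hs => ?_⟩
  have hs' := lt_min_iff.1 hs
  calc dist (f s) (f t) ≤ K * dist s t := key' s t hs'.1.le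
    _ ≤ (K + 1) * dist s t := by nlinarith [dist_nonneg (x := s) (y := t)]
    _ < ε := by
      have := hs'.2
      rwa [lt_div_iff₀ (by positivity), mul_comm] at this

/-- Flows are given by the semigroup. -/
theorem IsFlow.eq_semigroup {f : ℝ≥0 → S → ℝ} (hf : IsFlow rate f) (t : ℝ≥0) :
    f t = semigroup rate t (f 0) := by
  set F : ℝ → S → ℝ := fun t => f t.toNNReal with hF
  have hFc : Continuous F := hf.continuous.comp continuous_real_toNNReal
  have hder : ∀ x : ℝ, 0 ≤ x → HasDerivWithinAt F (generator rate (F x)) (Set.Ici x) x := by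
    intro x hx
    obtain ⟨-, C, hC⟩ := hf
    rw [hasDerivWithinAt_iff_isLittleO]
    have hO : (fun y => F y - F x - (y - x) • generator rate (F x)) =O[𝓝[Set.Ici x] x]
        fun y => (y - x) ^ 2 := by
      refine Asymptotics.IsBigO.of_bound C ?_
      have hmem : Set.Iic (x + 1) ∈ 𝓝[Set.Ici x] x :=
        mem_nhdsWithin_of_mem_nhds (Iic_mem_nhds (by linarith))
      filter_upwards [hmem, self_mem_nhdsWithin] with y hy hxy
      have hxy' : x ≤ y := hxy
      have hy' : y ≤ x + 1 := hy
      have := hC x.toNNReal (y - x).toNNReal (by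
        rw [← Real.toNNReal_one]; exact Real.toNNReal_mono (by linarith))
      rw [← Real.toNNReal_add hx (by linarith), add_sub_cancel,
        Real.coe_toNNReal _ (by linarith : 0 ≤ y - x)] at this
      rw [Real.norm_of_nonneg (sq_nonneg (y - x))]
      exact this
    refine hO.trans_isLittleO ?_
    have : (fun y : ℝ => (y - x) ^ 2) =o[𝓝 x] fun y => y - x := by
      have := (Asymptotics.isLittleO_pow_id (𝕜 := ℝ) (n := 2) (by norm_num)).comp_tendsto
        (show Tendsto (fun y : ℝ => y - x) (𝓝 x) (𝓝 0) by
          simpa using (continuous_sub_right x).tendsto x)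
      simpa [Function.comp_def] using this
    exact this.mono nhdsWithin_le_nhds
  -- Follow the flow up to time `x` and the semigroup for the remaining time `t - x`: the two
  -- derivatives cancel, so `G` is constant. Right derivatives suffice, and `approx` provides only
  -- those.
  set G : ℝ → S → ℝ := fun x => semigroup rate ((t : ℝ) - x) (F x) with hG
  have hG0 : ∀ x ∈ Set.Ico (0 : ℝ) t, HasDerivWithinAt G 0 (Set.Ici x) x := by
    intro x hx
    have h₁ := ((hasDerivAt_semigroup rate ((t : ℝ) - x)).comp_const_sub (t : ℝ) x
      ).hasDerivWithinAt (s := Set.Ici x)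
    refine (h₁.clm_apply (hder x hx.1)).congr_deriv ?_
    simp
  have hGc : ContinuousOn G (Set.Icc 0 t) := by
    refine Continuous.continuousOn ?_
    have h₁ : Continuous (semigroup rate) :=
      continuous_iff_continuousAt.2 fun x => (hasDerivAt_semigroup rate x).continuousAt
    exact (h₁.comp (continuous_const.sub continuous_id)).clm_apply hFc
  have := constant_of_has_deriv_right_zero hGc hG0 t ⟨t.2, le_rfl⟩
  simpa [hG, hF, semigroup_zero] using this

theorem isFlow_const {v : S → ℝ} (hv : generator rate v = 0) : IsFlow rate fun _ => v :=
  ⟨⟨‖v‖, fun _ => le_rfl⟩, 0, fun t h _ => by simp [hv]⟩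

theorem IsFlow.sub {f f' : ℝ≥0 → S → ℝ} (hf : IsFlow rate f) (hf' : IsFlow rate f') :
    IsFlow rate fun t => f t - f' t := by
  obtain ⟨⟨M, hM⟩, C, hC⟩ := hf
  obtain ⟨⟨M', hM'⟩, C', hC'⟩ := hf'
  refine ⟨⟨M + M', fun t => (norm_sub_le _ _).trans (add_le_add (hM t) (hM' t))⟩, C + C',
    fun t h hh => ?_⟩
  have heq : f (t + h) - f' (t + h) - (f t - f' t) - (h : ℝ) • generator rate (f t - f' t) =
      (f (t + h) - f t - (h : ℝ) • generator rate (f t)) -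
        (f' (t + h) - f' t - (h : ℝ) • generator rate (f' t)) := by
    rw [map_sub, smul_sub]
    abel
  rw [heq, add_mul]
  exact (norm_sub_le _ _).trans (add_le_add (hC t h hh) (hC' t h hh))

theorem single_one_nonneg {S : Type*} [DecidableEq S] (a b : S) : 0 ≤ (Pi.single a 1 : S → ℝ) b := by
  rw [Pi.single_apply]
  split_ifs <;> norm_num

/-- Doeblin's argument: as `w` has total mass zero, `ε` may be subtracted from every entry of the
kernel. What remains is nonnegative with row sums `1 - card S * ε`. -/
theorem sum_abs_semigroup_le (t : ℝ) {ε : ℝ} [DecidableEq S]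
    (hε : ∀ a b, ε ≤ semigroup rate t (Pi.single a 1) b) {w : S → ℝ} (hw : ∑ a, w a = 0) :
    ∑ b, |semigroup rate t w b| ≤ (1 - Fintype.card S * ε) * ∑ a, |w a| := by
  set k : S → S → ℝ := fun a b => semigroup rate t (Pi.single a 1) b with hk
  have hlin : ∀ b, semigroup rate t w b = ∑ a, w a * (k a b - ε) := by
    intro b
    have h₁ : w = ∑ a, w a • (Pi.single a 1 : S → ℝ) := by
      ext c
      simp [Finset.sum_apply, Pi.single_apply]
    conv_lhs => rw [h₁]
    rw [map_sum]
    simp only [map_smul, Finset.sum_apply, Pi.smul_apply, smul_eq_mul, mul_sub,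
      Finset.sum_sub_distrib, ← Finset.sum_mul, hw, zero_mul, sub_zero, hk]
  calc ∑ b, |semigroup rate t w b| ≤ ∑ b, ∑ a, |w a| * (k a b - ε) := by
        refine Finset.sum_le_sum fun b _ => ?_
        rw [hlin]
        refine (Finset.abs_sum_le_sum_abs _ _).trans (Finset.sum_le_sum fun a _ => ?_)
        rw [abs_mul, abs_of_nonneg (sub_nonneg.2 (hε a b))]
    _ = (1 - Fintype.card S * ε) * ∑ a, |w a| := by
        rw [Finset.sum_comm, Finset.mul_sum]
        refine Finset.sum_congr rfl fun a _ => ?_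
        rw [← Finset.mul_sum, Finset.sum_sub_distrib, hk, sum_semigroup]
        simp [mul_comm]

/-- Flows of total mass zero tend to zero. -/
theorem IsFlow.tendsto_zero
    (hirr : ∀ a b, Relation.ReflTransGen (fun a b => 0 < rate a b) a b)
    {w : ℝ≥0 → S → ℝ} (hw : IsFlow rate w) (h0 : ∀ t, ∑ a, w t a = 0) (b : S) :
    Tendsto (fun t => w t b) atTop (𝓝 0) := by
  classical
  have hpos : ∀ t : ℝ, 0 < t → ∀ a b, 0 < semigroup rate t (Pi.single a 1) b := fun t ht a b =>
    semigroup_pos rate hirr ht (single_one_nonneg a) (a := a) (by simp) b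
  obtain ⟨ε, hε, hε'⟩ : ∃ ε : ℝ, 0 < ε ∧ ∀ a b, ε ≤ semigroup rate 1 (Pi.single a 1) b := by
    have : Nonempty (S × S) := ⟨(b, b)⟩
    obtain ⟨p, hp⟩ := Finite.exists_min fun p : S × S => semigroup rate 1 (Pi.single p.1 1) p.2
    exact ⟨_, hpos 1 one_pos p.1 p.2, fun a b => hp (a, b)⟩
  -- The `ℓ¹` norm never grows and shrinks at least by the factor `ρ` in each unit of time; a
  -- general time is compared with its integer part.
  set V : ℝ≥0 → ℝ := fun t => ∑ a, |w t a| with hV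
  have hV0 : ∀ t, 0 ≤ V t := fun t => Finset.sum_nonneg fun _ _ => abs_nonneg _
  have hstep : ∀ s t : ℝ≥0, w (s + t) = semigroup rate t (w s) := fun s t => by
    simpa using (hw.shift s).eq_semigroup t
  have hmono : ∀ s t, V (s + t) ≤ V s := by
    intro s t
    have := sum_abs_semigroup_le (rate := rate) (t : ℝ) (ε := 0)
      (fun a b => semigroup_nonneg rate t.2 (single_one_nonneg a) b) (h0 s)
    simpa [hV, hstep] using this
  set ρ : ℝ := max 0 (1 - Fintype.card S * ε) with hρ
  have hρ0 : 0 ≤ ρ := le_max_left _ _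
  have hρ1 : ρ < 1 := by
    refine max_lt one_pos ?_
    have : (0 : ℝ) < Fintype.card S := by exact_mod_cast Fintype.card_pos_iff.2 ⟨b⟩
    nlinarith [mul_pos this hε]
  have hone : ∀ s, V (s + 1) ≤ ρ * V s := by
    intro s
    have := sum_abs_semigroup_le (rate := rate) 1 hε' (h0 s)
    rw [← NNReal.coe_one, ← hstep] at this
    exact this.trans (mul_le_mul_of_nonneg_right (le_max_right _ _) (hV0 s))
  have hnat : ∀ m : ℕ, V m ≤ ρ ^ m * V 0 := by
    intro m
    induction m with
    | zero => simp
    | succ m ih =>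
      rw [Nat.cast_succ, pow_succ', mul_assoc]
      exact (hone _).trans (mul_le_mul_of_nonneg_left ih hρ0)
  have hbound : ∀ t : ℝ≥0, |w t b| ≤ ρ ^ ⌊t⌋₊ * V 0 := by
    intro t
    obtain ⟨r, hr⟩ := exists_add_of_le (Nat.floor_le (zero_le (a := t)))
    calc |w t b| ≤ V t :=
          Finset.single_le_sum (f := fun a => |w t a|) (fun _ _ => abs_nonneg _) (Finset.mem_univ b)
      _ = V (⌊t⌋₊ + r) := by rw [← hr]
      _ ≤ V ⌊t⌋₊ := hmono _ _
      _ ≤ _ := hnat _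
  refine squeeze_zero_norm hbound ?_
  have := ((tendsto_pow_atTop_nhds_zero_of_lt_one hρ0 hρ1).comp
    (tendsto_nat_floor_atTop (α := ℝ≥0))).mul_const (V 0)
  simpa [Function.comp_def] using this

end Semigroup

/-! ### Jump chains with exponential holding times. -/

section JumpLaw

variable {S Ω : Type*} [Fintype S] [MeasurableSpace S] [DiscreteMeasurableSpace S]
  [MeasurableSpace Ω]

/-- The event that the first states and the first gaps of a jump chain are as prescribed. -/
def cylinder (X : ℕ → Ω → S) (T : ℕ → Ω → ℝ≥0∞) (k : ℕ) (a : ℕ → S) (r : ℕ → ℝ≥0) : Set Ω :=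
  {ω | (∀ i ≤ k, X i ω = a i) ∧ ∀ i < k, T i ω ≤ r i}

/-- The probability that the next gap is at most `r` and the next state is `b`. -/
noncomputable def stepProb (L : S → ℝ≥0) (κ : S → S → ℝ≥0) (a b : S) (r : ℝ≥0) : ℝ :=
  (1 - Real.exp (-((L a : ℝ) * r))) * κ a b

/-- The states `X` and the gaps `T` of a jump chain with holding rates `L` and jump kernel `κ`. -/
structure HasJumpLaw (P : Measure Ω) (X : ℕ → Ω → S) (T : ℕ → Ω → ℝ≥0∞) (L : S → ℝ≥0)
    (κ : S → S → ℝ≥0) : Prop where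
  measurable_state : ∀ k, Measurable (X k)
  measurable_gap : ∀ k, Measurable (T k)
  step : ∀ k a r, P (cylinder X T (k + 1) a r) =
    P (cylinder X T k a r) * ENNReal.ofReal (stepProb L κ (a k) (a (k + 1)) (r k))
  rate_pos : ∀ a, 0 < L a
  kernel_sum : ∀ a, ∑ b, κ a b = 1

variable {P : Measure Ω} {X : ℕ → Ω → S} {L : S → ℝ≥0} {κ : S → S → ℝ≥0}

omit [Fintype S] [MeasurableSpace S] [DiscreteMeasurableSpace S] [MeasurableSpace Ω] in
theorem one_sub_exp_nonneg (x y : ℝ≥0) : 0 ≤ 1 - Real.exp (-((x : ℝ) * y)) := by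
  rw [sub_nonneg, Real.exp_le_one_iff, neg_nonpos]
  positivity

omit [Fintype S] [MeasurableSpace S] [DiscreteMeasurableSpace S] in
theorem stepProb_nonneg (a b : S) (r : ℝ≥0) : 0 ≤ stepProb L κ a b r :=
  mul_nonneg (one_sub_exp_nonneg _ _) (NNReal.coe_nonneg _)

theorem sum_measure_inter_eq {X : Ω → S} (hX : Measurable X) (A : Set Ω) :
    ∑ b, P (A ∩ {ω | X ω = b}) = P A := by
  have h := sum_measure_preimage_singleton (μ := P.restrict A) Finset.univ (f := X)
    fun y _ => hX (MeasurableSet.singleton y)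
  simp only [Finset.coe_univ, Set.preimage_univ, Measure.restrict_apply_univ] at h
  rw [← h]
  refine Finset.sum_congr rfl fun b _ => ?_
  rw [Measure.restrict_apply (hX (MeasurableSet.singleton b)), Set.inter_comm]
  rfl

theorem measurableSet_cylinder {T : ℕ → Ω → ℝ≥0∞} (hX : ∀ k, Measurable (X k))
    (hT : ∀ k, Measurable (T k)) (k : ℕ) (a : ℕ → S) (r : ℕ → ℝ≥0) :
    MeasurableSet (cylinder X T k a r) := by
  have : cylinder X T k a r =
      (⋂ i, ⋂ (_ : i ≤ k), X i ⁻¹' {a i}) ∩ ⋂ i, ⋂ (_ : i < k), T i ⁻¹' Set.Iic (r i : ℝ≥0∞) := by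
    ext ω; simp [cylinder]
  rw [this]
  exact (MeasurableSet.iInter fun i => .iInter fun _ => hX i (.singleton _)).inter
    (.iInter fun i => .iInter fun _ => hT i measurableSet_Iic)

omit [Fintype S] [MeasurableSpace S] [DiscreteMeasurableSpace S] [MeasurableSpace Ω] in
theorem cylinder_succ {T : ℕ → Ω → ℝ≥0∞} (k : ℕ) (a : ℕ → S) (r : ℕ → ℝ≥0) (b : S) (u : ℝ≥0) :
    cylinder X T (k + 1) (Function.update a (k + 1) b) (Function.update r k u) =
      cylinder X T k a r ∩ {ω | X (k + 1) ω = b ∧ T k ω ≤ u} := by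
  ext ω
  simp only [cylinder, Set.mem_inter_iff, Set.mem_ofPred_eq]
  constructor
  · rintro ⟨h₁, h₂⟩
    refine ⟨⟨fun i hi => ?_, fun i hi => ?_⟩, ?_, ?_⟩
    · have := h₁ i (by omega)
      rwa [Function.update_of_ne (by omega)] at this
    · have := h₂ i (by omega)
      rwa [Function.update_of_ne (by omega)] at this
    · simpa using h₁ (k + 1) le_rfl
    · simpa using h₂ k (by omega)
  · rintro ⟨⟨h₁, h₂⟩, h₃, h₄⟩
    refine ⟨fun i hi => ?_, fun i hi => ?_⟩
    · rcases Nat.lt_or_ge i (k + 1) with h | h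
      · rw [Function.update_of_ne (by omega)]; exact h₁ i (by omega)
      · obtain rfl : i = k + 1 := by omega
        simpa using h₃
    · rcases Nat.lt_or_ge i k with h | h
      · rw [Function.update_of_ne (by omega)]; exact h₂ i h
      · obtain rfl : i = k := by omega
        simpa using h₄

omit [DiscreteMeasurableSpace S] in
theorem HasJumpLaw.measure_cylinder_inter {T : ℕ → Ω → ℝ≥0∞} (h : HasJumpLaw P X T L κ) (k : ℕ)
    (a : ℕ → S) (r : ℕ → ℝ≥0) (b : S) (u : ℝ≥0) :
    P (cylinder X T k a r ∩ {ω | X (k + 1) ω = b ∧ T k ω ≤ u}) =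
      P (cylinder X T k a r) * ENNReal.ofReal (stepProb L κ (a k) b u) := by
  rw [← cylinder_succ, h.step]
  simp only [Function.update_self, Function.update_of_ne (show k ≠ k + 1 by omega)]
  congr 2
  ext ω
  simp only [cylinder, Set.mem_ofPred_eq]
  refine and_congr (forall₂_congr fun i hi => ?_) (forall₂_congr fun i hi => ?_)
  · rw [Function.update_of_ne (by omega)]
  · rw [Function.update_of_ne (by omega)]

omit [DiscreteMeasurableSpace S] in
theorem HasJumpLaw.sum_stepProb {T : ℕ → Ω → ℝ≥0∞} (h : HasJumpLaw P X T L κ) (a : S) (u : ℝ≥0) :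
    ∑ b, ENNReal.ofReal (stepProb L κ a b u) =
      ENNReal.ofReal (1 - Real.exp (-((L a : ℝ) * u))) := by
  rw [← ENNReal.ofReal_sum_of_nonneg fun b _ => stepProb_nonneg a b u]
  congr 1
  simp only [stepProb, ← Finset.mul_sum]
  rw [← NNReal.coe_sum, h.kernel_sum, NNReal.coe_one, mul_one]

theorem HasJumpLaw.measure_cylinder_inter_gap {T : ℕ → Ω → ℝ≥0∞} (h : HasJumpLaw P X T L κ)
    (k : ℕ) (a : ℕ → S) (r : ℕ → ℝ≥0) (u : ℝ≥0) :
    P (cylinder X T k a r ∩ {ω | T k ω ≤ u}) =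
      P (cylinder X T k a r) * ENNReal.ofReal (1 - Real.exp (-((L (a k) : ℝ) * u))) := by
  rw [← sum_measure_inter_eq (h.measurable_state (k + 1)), ← h.sum_stepProb, Finset.mul_sum]
  refine Finset.sum_congr rfl fun b _ => ?_
  rw [← h.measure_cylinder_inter]
  congr 1
  ext ω
  simp only [Set.mem_inter_iff, Set.mem_ofPred_eq]
  tauto

/-- Countably many cylinders cover the event that the gaps so far are finite. -/
def cylinderCover (X : ℕ → Ω → S) (T : ℕ → Ω → ℝ≥0∞) (k : ℕ) (p : (Fin (k + 1) → S) × ℕ) :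
    Set Ω :=
  -- `Fin.ofNat` reduces indices modulo `k + 1`; a cylinder looks only at `i ≤ k`, where this
  -- changes nothing.
  cylinder X T k (fun i => p.1 (Fin.ofNat (k + 1) i)) fun _ => (p.2 : ℝ≥0)

omit [Fintype S] [MeasurableSpace S] [DiscreteMeasurableSpace S] [MeasurableSpace Ω] in
theorem exists_mem_cylinderCover {T : ℕ → Ω → ℝ≥0∞} {k : ℕ} {ω : Ω}
    (hω : ∀ i < k, T i ω < ∞) :
    ∃ m : ℕ, ω ∈ cylinderCover X T k (fun i => X i ω, m) ∧ ∀ i < k, T i ω ≤ (m : ℝ≥0) := by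
  have h : ∀ i, ∃ m : ℕ, i < k → T i ω ≤ m := fun i => by
    by_cases hi : i < k
    · obtain ⟨m, hm⟩ := ENNReal.exists_nat_gt (hω i hi).ne
      exact ⟨m, fun _ => hm.le⟩
    · exact ⟨0, fun h => absurd h hi⟩
  choose m hm using h
  have key : ∀ i < k, T i ω ≤ ((∑ j ∈ Finset.range k, m j : ℕ) : ℝ≥0) := fun i hi => by
    refine (hm i hi).trans ?_
    have := Finset.single_le_sum (f := m) (fun _ _ => Nat.zero_le _) (Finset.mem_range.2 hi)
    exact_mod_cast this
  refine ⟨∑ j ∈ Finset.range k, m j, ⟨fun i hi => ?_, key⟩, key⟩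
  simp [Fin.ofNat, Nat.mod_eq_of_lt (Nat.lt_succ_of_le hi)]

/-- On each cylinder the gap exceeds `m` with a probability that decays exponentially in `m`. By
induction the earlier gaps are almost surely finite, so countably many cylinders cover almost
everything. -/
theorem HasJumpLaw.ae_gap_lt_top [IsFiniteMeasure P] {T : ℕ → Ω → ℝ≥0∞}
    (h : HasJumpLaw P X T L κ) (k : ℕ) : ∀ᵐ ω ∂P, T k ω < ∞ := by
  induction k using Nat.strong_induction_on with
  | _ k ih =>
  have hcyl : ∀ a r, P (cylinder X T k a r ∩ {ω | T k ω = ∞}) = 0 := by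
    intro a r
    set C := cylinder X T k a r with hC
    have hmC : MeasurableSet C := measurableSet_cylinder h.measurable_state h.measurable_gap k a r
    have hle : ∀ m : ℕ, P.real (C ∩ {ω | T k ω = ∞}) ≤
        P.real C * Real.exp (-((L (a k) : ℝ) * m)) := by
      intro m
      have hdisj : Disjoint (C ∩ {ω | T k ω = ∞}) (C ∩ {ω | T k ω ≤ (m : ℝ≥0)}) := by
        rw [Set.disjoint_left]
        rintro ω ⟨-, h₁⟩ ⟨-, h₂⟩
        simp only [Set.mem_ofPred_eq] at h₁ h₂
        rw [h₁] at h₂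
        exact absurd h₂ (by simp)
      have h₁ := measureReal_union (μ := P) hdisj
        (hmC.inter (h.measurable_gap k measurableSet_Iic))
      have h₂ : P.real (C ∩ {ω | T k ω = ∞} ∪ C ∩ {ω | T k ω ≤ (m : ℝ≥0)}) ≤ P.real C :=
        measureReal_mono (Set.union_subset Set.inter_subset_left Set.inter_subset_left)
      have h₃ : P.real (C ∩ {ω | T k ω ≤ (m : ℝ≥0)}) =
          P.real C * (1 - Real.exp (-((L (a k) : ℝ) * m))) := by
        rw [Measure.real, h.measure_cylinder_inter_gap, ENNReal.toReal_mul,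
          ENNReal.toReal_ofReal (one_sub_exp_nonneg _ _)]
        simp [Measure.real, hC]
      linarith
    have hlim : Tendsto (fun m : ℕ => P.real C * Real.exp (-((L (a k) : ℝ) * m))) atTop (𝓝 0) := by
      have h₁ : Tendsto (fun m : ℕ => (L (a k) : ℝ) * m) atTop atTop :=
        tendsto_natCast_atTop_atTop.const_mul_atTop (by exact_mod_cast h.rate_pos (a k))
      simpa using (Real.tendsto_exp_neg_atTop_nhds_zero.comp h₁).const_mul (P.real C)
    have h0 := ge_of_tendsto' hlim hle
    exact (measureReal_eq_zero_iff).1 (le_antisymm h0 measureReal_nonneg)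
  have hnull : P (⋃ p, cylinderCover X T k p ∩ {ω | T k ω = ∞}) = 0 :=
    measure_iUnion_null fun p => hcyl _ _
  have hih : ∀ᵐ ω ∂P, ∀ i, i < k → T i ω < ∞ := ae_all_iff.2 fun i => by
    by_cases hi : i < k
    · filter_upwards [ih i hi] with ω hω _ using hω
    · exact .of_forall fun ω h => absurd h hi
  filter_upwards [hih, compl_mem_ae_iff.2 hnull] with ω hω hω'
  by_contra hcon
  obtain ⟨m, hm, -⟩ := exists_mem_cylinderCover (X := X) hω
  exact hω' (Set.mem_iUnion.2 ⟨_, hm, by simpa using hcon⟩)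

/-! ### Independence of the past -/

/-- The events that depend on the first `k` gaps and the first `k + 1` states. -/
@[reducible]
def past (X : ℕ → Ω → S) (T : ℕ → Ω → ℝ≥0) (k : ℕ) : MeasurableSpace Ω :=
  MeasurableSpace.generateFrom {A | ∃ a r, A = cylinder X (fun i ω => (T i ω : ℝ≥0∞)) k a r}

variable {T : ℕ → Ω → ℝ≥0}

omit [Fintype S] [MeasurableSpace S] [DiscreteMeasurableSpace S] [MeasurableSpace Ω] in
theorem sUnion_cylinderCover (k : ℕ) :
    ⋃₀ Set.range (cylinderCover X (fun i ω => (T i ω : ℝ≥0∞)) k) = Set.univ := by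
  refine Set.eq_univ_of_forall fun ω => ?_
  obtain ⟨m, hm, -⟩ := exists_mem_cylinderCover (X := X) (T := fun i ω => (T i ω : ℝ≥0∞)) (k := k)
    (ω := ω) fun i _ => ENNReal.coe_lt_top
  exact ⟨_, ⟨_, rfl⟩, hm⟩

omit [DiscreteMeasurableSpace S] [MeasurableSpace Ω] in
theorem measurable_state_past {k i : ℕ} (hi : i ≤ k) : Measurable[past X T k] (X i) := by
  refine @measurable_to_countable' S Ω _ _ (past X T k) _ fun s => ?_
  have : X i ⁻¹' {s} = ⋃ p : {p : (Fin (k + 1) → S) × ℕ // p.1 (Fin.ofNat (k + 1) i) = s},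
      cylinderCover X (fun i ω => (T i ω : ℝ≥0∞)) k p.1 := by
    ext ω
    simp only [Set.mem_preimage, Set.mem_singleton_iff, Set.mem_iUnion, Subtype.exists]
    constructor
    · rintro rfl
      obtain ⟨m, hm, -⟩ := exists_mem_cylinderCover (X := X) (T := fun i ω => (T i ω : ℝ≥0∞))
        (k := k) (ω := ω) fun i _ => ENNReal.coe_lt_top
      exact ⟨_, by simp [Fin.ofNat, Nat.mod_eq_of_lt (Nat.lt_succ_of_le hi)], hm⟩
    · rintro ⟨p, rfl, hp⟩
      exact hp.1 i hi
  rw [this]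
  exact MeasurableSet.iUnion fun p => MeasurableSpace.measurableSet_generateFrom ⟨_, _, rfl⟩

omit [MeasurableSpace S] [DiscreteMeasurableSpace S] [MeasurableSpace Ω] in
theorem measurable_gap_past {k i : ℕ} (hi : i < k) : Measurable[past X T k] (T i) := by
  refine @measurable_of_Iic ℝ≥0 Ω _ _ _ (past X T k) _ _ _ _ fun u => ?_
  have : T i ⁻¹' Set.Iic u = ⋃ p : (Fin (k + 1) → S) × ℕ,
      cylinder X (fun i ω => (T i ω : ℝ≥0∞)) k (fun i => p.1 (Fin.ofNat (k + 1) i))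
        (Function.update (fun _ => (p.2 : ℝ≥0)) i u) := by
    ext ω
    simp only [Set.mem_preimage, Set.mem_Iic, Set.mem_iUnion]
    constructor
    · intro hu
      obtain ⟨m, hm, -⟩ := exists_mem_cylinderCover (X := X) (T := fun i ω => (T i ω : ℝ≥0∞))
        (k := k) (ω := ω) fun i _ => ENNReal.coe_lt_top
      refine ⟨_, hm.1, fun j hj => ?_⟩
      by_cases hji : j = i
      · subst hji; simpa using hu
      · rw [Function.update_of_ne hji]; exact hm.2 j hj
    · rintro ⟨p, -, hp⟩
      simpa using hp i hi
  rw [this]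
  exact MeasurableSet.iUnion fun p => MeasurableSpace.measurableSet_generateFrom ⟨_, _, rfl⟩

theorem past_le (hX : ∀ k, Measurable (X k)) (hT : ∀ k, Measurable (T k)) (k : ℕ) :
    past X T k ≤ ‹MeasurableSpace Ω› := by
  refine MeasurableSpace.generateFrom_le ?_
  rintro _ ⟨a, r, rfl⟩
  exact measurableSet_cylinder hX (fun i => (hT i).coe_nnreal_ennreal) k a r

omit [Fintype S] [MeasurableSpace S] [DiscreteMeasurableSpace S] [MeasurableSpace Ω] in
theorem isPiSystem_cylinder (T : ℕ → Ω → ℝ≥0∞) (k : ℕ) :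
    IsPiSystem {A | ∃ a r, A = cylinder X T k a r} := by
  rintro _ ⟨a, r, rfl⟩ _ ⟨a', r', rfl⟩ ⟨ω, hω, hω'⟩
  refine ⟨a, fun i => min (r i) (r' i), ?_⟩
  have haa : ∀ i ≤ k, a i = a' i := fun i hi => (hω.1 i hi).symm.trans (hω'.1 i hi)
  ext ω'
  simp only [cylinder, Set.mem_inter_iff, Set.mem_ofPred_eq, ENNReal.coe_min, le_min_iff]
  constructor
  · rintro ⟨⟨h₁, h₂⟩, -, h₃⟩
    exact ⟨h₁, fun i hi => ⟨h₂ i hi, h₃ i hi⟩⟩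
  · rintro ⟨h₁, h₂⟩
    exact ⟨⟨h₁, fun i hi => (h₂ i hi).1⟩, fun i hi => (h₁ i hi).trans (haa i hi),
      fun i hi => (h₂ i hi).2⟩

/-- Given the past, the next gap and the next state depend on the present state only. -/
theorem HasJumpLaw.measure_past_inter [IsFiniteMeasure P]
    (h : HasJumpLaw P X (fun i ω => (T i ω : ℝ≥0∞)) L κ) (hT : ∀ k, Measurable (T k)) {k : ℕ}
    {A : Set Ω} (hA : MeasurableSet[past X T k] A) (a b : S) (u : ℝ≥0) :
    P (A ∩ {ω | X k ω = a ∧ X (k + 1) ω = b ∧ T k ω ≤ u}) =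
      P (A ∩ {ω | X k ω = a}) * ENNReal.ofReal (stepProb L κ a b u) := by
  have hle := past_le h.measurable_state hT k
  have hmA : MeasurableSet A := hle _ hA
  have hm₁ : ∀ c : S, MeasurableSet {ω | X k ω = c} := fun c => h.measurable_state k (.singleton c)
  set c := ENNReal.ofReal (stepProb L κ a b u) with hc
  -- As functions of `A`, both sides are measures on the past. They agree on the cylinders, which
  -- form a π-system and of which countably many cover `Ω`; cylinders with another `k`-th state
  -- contribute zero.
  have key : (P.restrict {ω | X k ω = a ∧ X (k + 1) ω = b ∧ T k ω ≤ u}).trim hle =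
      (c • P.restrict {ω | X k ω = a}).trim hle := by
    refine @Measure.ext_of_generateFrom_of_cover_subset Ω (past X T k) _ _
      {A | ∃ a r, A = cylinder X (fun i ω => (T i ω : ℝ≥0∞)) k a r}
      (Set.range (cylinderCover X (fun i ω => (T i ω : ℝ≥0∞)) k)) rfl (isPiSystem_cylinder _ k)
      ?_ (Set.countable_range _) (sUnion_cylinderCover k) (fun _ _ => ?_) ?_
    · rintro _ ⟨p, rfl⟩
      exact ⟨_, _, rfl⟩
    · have : IsFiniteMeasure ((P.restrict {ω | X k ω = a ∧ X (k + 1) ω = b ∧ T k ω ≤ u}).trim hle) :=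
        isFiniteMeasure_trim hle
      exact measure_ne_top _ _
    · rintro _ ⟨a', r', rfl⟩
      have hmc : MeasurableSet[past X T k] (cylinder X (fun i ω => (T i ω : ℝ≥0∞)) k a' r') :=
        MeasurableSpace.measurableSet_generateFrom ⟨_, _, rfl⟩
      rw [trim_measurableSet_eq hle hmc, trim_measurableSet_eq hle hmc, Measure.smul_apply,
        Measure.restrict_apply (hle _ hmc), Measure.restrict_apply (hle _ hmc), smul_eq_mul]
      by_cases hak : a' k = a
      · have h₁ : cylinder X (fun i ω => (T i ω : ℝ≥0∞)) k a' r' ∩ {ω | X k ω = a} =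
            cylinder X (fun i ω => (T i ω : ℝ≥0∞)) k a' r' :=
          Set.inter_eq_left.2 fun ω hω => (hω.1 k le_rfl).trans hak
        have h₂ : cylinder X (fun i ω => (T i ω : ℝ≥0∞)) k a' r' ∩
            {ω | X k ω = a ∧ X (k + 1) ω = b ∧ T k ω ≤ u} =
            cylinder X (fun i ω => (T i ω : ℝ≥0∞)) k a' r' ∩
            {ω | X (k + 1) ω = b ∧ (T k ω : ℝ≥0∞) ≤ u} := by
          ext ω
          simp only [Set.mem_inter_iff, Set.mem_ofPred_eq, ENNReal.coe_le_coe]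
          exact ⟨fun ⟨h₁, _, h₂⟩ => ⟨h₁, h₂⟩, fun ⟨h₁, h₂⟩ => ⟨h₁, (h₁.1 k le_rfl).trans hak, h₂⟩⟩
        rw [h₁, h₂, h.measure_cylinder_inter, hak, mul_comm]
      · have h₁ : ∀ B : Set Ω, B ⊆ {ω | X k ω = a} →
            cylinder X (fun i ω => (T i ω : ℝ≥0∞)) k a' r' ∩ B = ∅ := fun B hB => by
          refine Set.eq_empty_of_forall_notMem fun ω hω => hak ?_
          exact (hω.1.1 k le_rfl).symm.trans (hB hω.2)
        rw [h₁ _ fun ω hω => hω.1, h₁ _ subset_rfl]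
        simp
  have := congrArg (fun μ => μ A) key
  rwa [trim_measurableSet_eq hle hA, trim_measurableSet_eq hle hA, Measure.smul_apply,
    Measure.restrict_apply hmA, Measure.restrict_apply hmA, smul_eq_mul, mul_comm] at this

/-! ### The holding time at a fixed time -/

/-- The exponential distribution on `ℝ≥0`. -/
noncomputable def expDist (r : ℝ≥0) : Measure ℝ≥0 := (expMeasure r).map Real.toNNReal

theorem isProbabilityMeasure_expDist {r : ℝ≥0} (hr : 0 < r) : IsProbabilityMeasure (expDist r) :=
  have := isProbabilityMeasure_expMeasure (r := (r : ℝ)) hr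
  Measure.isProbabilityMeasure_map measurable_real_toNNReal.aemeasurable

theorem expDist_Iic {r : ℝ≥0} (hr : 0 < r) (x : ℝ≥0) :
    expDist r (Set.Iic x) = ENNReal.ofReal (1 - Real.exp (-((r : ℝ) * x))) := by
  have := isProbabilityMeasure_expMeasure (r := (r : ℝ)) hr
  rw [expDist, Measure.map_apply measurable_real_toNNReal measurableSet_Iic]
  have h : Real.toNNReal ⁻¹' Set.Iic x = Set.Iic (x : ℝ) := by
    ext y; simp [Real.toNNReal_le_iff_le_coe]
  rw [h, ← ofReal_cdf, cdf_expMeasure_eq (by exact_mod_cast hr), if_pos (NNReal.coe_nonneg x)]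

theorem expDist_Ioi {r : ℝ≥0} (hr : 0 < r) (x : ℝ≥0) :
    expDist r (Set.Ioi x) = ENNReal.ofReal (Real.exp (-((r : ℝ) * x))) := by
  have := isProbabilityMeasure_expDist hr
  rw [← Set.compl_Iic, prob_compl_eq_one_sub measurableSet_Iic, expDist_Iic hr,
    ← ENNReal.ofReal_one, ← ENNReal.ofReal_sub _ (one_sub_exp_nonneg _ _), sub_sub_cancel]

/-- The exponential distribution has no memory. -/
theorem expDist_Ioc {r : ℝ≥0} (hr : 0 < r) (x h : ℝ≥0) : expDist r (Set.Ioc x (x + h)) =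
    expDist r (Set.Ioi x) * ENNReal.ofReal (1 - Real.exp (-((r : ℝ) * h))) := by
  have := isProbabilityMeasure_expDist hr
  have heq : Set.Ioc x (x + h) = Set.Iic (x + h) \ Set.Iic x := by
    ext y; simp [and_comm]
  rw [heq, measure_sdiff (Set.Iic_subset_Iic.2 le_self_add) measurableSet_Iic.nullMeasurableSet
    (measure_ne_top _ _), expDist_Iic hr, expDist_Iic hr, expDist_Ioi hr,
    ← ENNReal.ofReal_sub _ (one_sub_exp_nonneg _ _), ← ENNReal.ofReal_mul (Real.exp_pos _).le]
  congr 1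
  rw [mul_sub, ← Real.exp_add]
  push_cast
  ring_nf

/-- The time of the `k`-th jump. -/
noncomputable def arrival (T : ℕ → Ω → ℝ≥0) (k : ℕ) (ω : Ω) : ℝ≥0 := ∑ i ∈ Finset.range k, T i ω

omit [MeasurableSpace Ω] in
theorem arrival_succ (k : ℕ) (ω : Ω) : arrival T (k + 1) ω = arrival T k ω + T k ω :=
  Finset.sum_range_succ _ _

omit [MeasurableSpace S] [DiscreteMeasurableSpace S] [MeasurableSpace Ω] in
theorem measurable_arrival_past (k : ℕ) {j : ℕ} (hj : j ≤ k) :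
    Measurable[past X T k] (arrival T j) :=
  Finset.measurable_sum (m := past X T k) _ fun _ hi =>
    measurable_gap_past ((Finset.mem_range.1 hi).trans_le hj)

/-- The event that the chain is in its `k`-th state at time `s`, which is `a`. -/
def occupies (X : ℕ → Ω → S) (T : ℕ → Ω → ℝ≥0) (k : ℕ) (a : S) (s : ℝ≥0) : Set Ω :=
  {ω | X k ω = a ∧ arrival T k ω ≤ s ∧ s < arrival T (k + 1) ω}

section Holding

variable [IsFiniteMeasure P] (h : HasJumpLaw P X (fun i ω => (T i ω : ℝ≥0∞)) L κ)
  (hT : ∀ k, Measurable (T k))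

include h hT

/-- The `k`-th arrival time belongs to the past of the `k`-th jump; given the state `a`, it is
therefore independent of the next gap and the next state. -/
theorem HasJumpLaw.map_arrival_gap (k : ℕ) (a b : S) :
    (P.restrict {ω | X k ω = a ∧ X (k + 1) ω = b}).map (fun ω => (arrival T k ω, T k ω)) =
      ((P.restrict {ω | X k ω = a}).map (arrival T k)).prod ((κ a b : ℝ≥0∞) • expDist (L a)) := by
  have := isProbabilityMeasure_expDist (h.rate_pos a)
  have : IsFiniteMeasure ((κ a b : ℝ≥0∞) • expDist (L a)) :=
    Measure.smul_finite _ ENNReal.coe_ne_top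
  have hτ : Measurable (arrival T k) :=
    (measurable_arrival_past (X := X) k le_rfl).mono (past_le h.measurable_state hT k) le_rfl
  have hm₁ : MeasurableSet {ω | X k ω = a} := h.measurable_state k (.singleton a)
  have hm₂ : MeasurableSet {ω | X k ω = a ∧ X (k + 1) ω = b} :=
    hm₁.inter (h.measurable_state (k + 1) (.singleton b))
  symm
  refine Measure.prod_eq fun s t hs ht => ?_
  rw [Measure.map_apply (hτ.prodMk (hT k)) (hs.prod ht), Measure.map_apply hτ hs,
    Measure.restrict_apply (hτ hs)]
  set A := arrival T k ⁻¹' s with hA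
  have hmA : MeasurableSet A := hτ hs
  have hpA : MeasurableSet[past X T k] A := measurable_arrival_past k le_rfl hs
  have key : ((P.restrict {ω | X k ω = a ∧ X (k + 1) ω = b}).restrict A).map (T k) =
      P (A ∩ {ω | X k ω = a}) • ((κ a b : ℝ≥0∞) • expDist (L a)) := by
    refine Measure.ext_of_Iic _ _ fun u => ?_
    rw [Measure.map_apply (hT k) measurableSet_Iic,
      Measure.restrict_apply (hT k measurableSet_Iic),
      Measure.restrict_apply ((hT k measurableSet_Iic).inter hmA), Measure.smul_apply,
      Measure.smul_apply, expDist_Iic (h.rate_pos a), smul_eq_mul, smul_eq_mul]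
    have hset : T k ⁻¹' Set.Iic u ∩ A ∩ {ω | X k ω = a ∧ X (k + 1) ω = b} =
        A ∩ {ω | X k ω = a ∧ X (k + 1) ω = b ∧ T k ω ≤ u} := by
      ext ω
      simp only [Set.mem_inter_iff, Set.mem_preimage, Set.mem_Iic, Set.mem_ofPred_eq]
      tauto
    rw [hset, h.measure_past_inter hT hpA, stepProb, mul_comm (1 - _),
      ENNReal.ofReal_mul (NNReal.coe_nonneg _), ENNReal.ofReal_coe_nnreal]
  have := congrArg (fun μ => μ t) key
  simp only [Measure.smul_apply] at this
  rw [Measure.map_apply (hT k) ht, Measure.restrict_apply (hT k ht)] at this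
  rw [Measure.smul_apply, ← smul_eq_mul (P _), ← this]
  congr 1
  ext ω
  simp [hA, and_comm]

theorem HasJumpLaw.measure_arrival_gap {B : Set (ℝ≥0 × ℝ≥0)} (hB : MeasurableSet B) (k : ℕ)
    (a b : S) :
    P {ω | X k ω = a ∧ X (k + 1) ω = b ∧ (arrival T k ω, T k ω) ∈ B} =
      κ a b * ∫⁻ u, expDist (L a) (Prod.mk u ⁻¹' B)
        ∂((P.restrict {ω | X k ω = a}).map (arrival T k)) := by
  have := isProbabilityMeasure_expDist (h.rate_pos a)
  have hτ : Measurable (arrival T k) :=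
    (measurable_arrival_past (X := X) k le_rfl).mono (past_le h.measurable_state hT k) le_rfl
  have : IsFiniteMeasure ((κ a b : ℝ≥0∞) • expDist (L a)) :=
    Measure.smul_finite _ ENNReal.coe_ne_top
  have hm := congrArg (fun μ => μ B) (h.map_arrival_gap hT k a b)
  rw [Measure.map_apply (hτ.prodMk (hT k)) hB, Measure.restrict_apply ((hτ.prodMk (hT k)) hB),
    Measure.prod_apply hB] at hm
  simp only [Measure.smul_apply, smul_eq_mul] at hm
  rw [lintegral_const_mul _ (measurable_measure_prodMk_left hB)] at hm
  rw [← hm]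
  congr 1
  ext ω
  simp only [Set.mem_ofPred_eq, Set.mem_inter_iff, Set.mem_preimage]
  tauto

/-- If state number `k` is entered at time `u ≤ s`, the process is still there at time `s` iff the
gap exceeds `s - u`. -/
theorem HasJumpLaw.measure_occupies (k : ℕ) (a : S) (s : ℝ≥0) :
    P (occupies X T k a s) = ∫⁻ u in Set.Iic s, expDist (L a) (Set.Ioi (s - u))
        ∂((P.restrict {ω | X k ω = a}).map (arrival T k)) := by
  set B : Set (ℝ≥0 × ℝ≥0) := {p | p.1 ≤ s ∧ s < p.1 + p.2} with hB
  have hmB : MeasurableSet B := (measurableSet_le measurable_fst measurable_const).inter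
    (measurableSet_lt measurable_const (by fun_prop))
  rw [← sum_measure_inter_eq (h.measurable_state (k + 1))]
  have hset : ∀ b, occupies X T k a s ∩ {ω | X (k + 1) ω = b} =
      {ω | X k ω = a ∧ X (k + 1) ω = b ∧ (arrival T k ω, T k ω) ∈ B} := by
    intro b
    ext ω
    simp only [occupies, arrival_succ, hB, Set.mem_inter_iff, Set.mem_ofPred_eq]
    tauto
  simp only [hset, h.measure_arrival_gap hT hmB]
  rw [← Finset.sum_mul, ← ENNReal.ofNNReal_finsetSum, h.kernel_sum, ENNReal.coe_one, one_mul,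
    ← lintegral_indicator measurableSet_Iic]
  refine lintegral_congr fun u => ?_
  by_cases hu : u ≤ s
  · rw [Set.indicator_of_mem (show u ∈ Set.Iic s from hu)]
    congr 1
    ext v
    simp [hB, hu, tsub_lt_iff_left hu]
  · rw [Set.indicator_of_notMem (show u ∉ Set.Iic s from hu)]
    have : Prod.mk u ⁻¹' B = ∅ := Set.eq_empty_of_forall_notMem fun v hv => hu hv.1
    rw [this, measure_empty]

/-- Given the state at time `s`, the next jump happens until time `s + u` and leads to `b` with the
same probability as after a jump. -/
theorem HasJumpLaw.measure_occupies_inter (k : ℕ) (a b : S) (s u : ℝ≥0) :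
    P (occupies X T k a s ∩ {ω | X (k + 1) ω = b ∧ arrival T (k + 1) ω ≤ s + u}) =
      P (occupies X T k a s) * ENNReal.ofReal (stepProb L κ a b u) := by
  set B : Set (ℝ≥0 × ℝ≥0) := {p | p.1 ≤ s ∧ s < p.1 + p.2 ∧ p.1 + p.2 ≤ s + u} with hB
  have hmB : MeasurableSet B := (measurableSet_le measurable_fst measurable_const).inter
    ((measurableSet_lt measurable_const (by fun_prop)).inter
      (measurableSet_le (by fun_prop) measurable_const))
  have hset : occupies X T k a s ∩ {ω | X (k + 1) ω = b ∧ arrival T (k + 1) ω ≤ s + u} =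
      {ω | X k ω = a ∧ X (k + 1) ω = b ∧ (arrival T k ω, T k ω) ∈ B} := by
    ext ω
    simp only [occupies, arrival_succ, hB, Set.mem_inter_iff, Set.mem_ofPred_eq]
    tauto
  rw [hset, h.measure_arrival_gap hT hmB, h.measure_occupies hT,
    ← lintegral_indicator measurableSet_Iic]
  -- After arrival at `v ≤ s` the gap must lie in `(s - v, s - v + u]`. By lack of memory the factor
  -- for the length `u` does not depend on `v` and leaves the integral.
  have hint : ∀ v, expDist (L a) (Prod.mk v ⁻¹' B) =
      (Set.Iic s).indicator (fun v => expDist (L a) (Set.Ioi (s - v))) v *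
        ENNReal.ofReal (1 - Real.exp (-((L a : ℝ) * u))) := by
    intro v
    by_cases hv : v ≤ s
    · rw [Set.indicator_of_mem (show v ∈ Set.Iic s from hv), ← expDist_Ioc (h.rate_pos a)]
      congr 1
      ext w
      simp only [hB, Set.mem_preimage, Set.mem_ofPred_eq, hv, true_and, Set.mem_Ioc,
        tsub_lt_iff_left hv]
      rw [tsub_add_eq_add_tsub hv, le_tsub_iff_left (hv.trans le_self_add)]
    · rw [Set.indicator_of_notMem (show v ∉ Set.Iic s from hv), zero_mul]
      have : Prod.mk v ⁻¹' B = ∅ := Set.eq_empty_of_forall_notMem fun w hw => hv hw.1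
      rw [this, measure_empty]
  simp only [hint]
  rw [lintegral_mul_const' _ _ ENNReal.ofReal_ne_top, stepProb,
    ENNReal.ofReal_mul (one_sub_exp_nonneg _ _), ENNReal.ofReal_coe_nnreal]
  ring

/-- Two jumps in a short time are unlikely. -/
theorem HasJumpLaw.measure_occupies_inter_two {M : ℝ≥0} (hM : ∀ a, L a ≤ M) (k : ℕ) (a : S)
    (s u : ℝ≥0) :
    P (occupies X T k a s ∩ {ω | arrival T (k + 1) ω ≤ s + u ∧ T (k + 1) ω ≤ u}) ≤
      P (occupies X T k a s) * ENNReal.ofReal ((M * u) ^ 2) := by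
  have hexp : ∀ a, 1 - Real.exp (-((L a : ℝ) * u)) ≤ M * u := fun a => by
    have h₁ := Real.add_one_le_exp (-((L a : ℝ) * u))
    have h₂ : (L a : ℝ) * u ≤ M * u :=
      mul_le_mul_of_nonneg_right (by exact_mod_cast hM a) u.2
    linarith
  -- `A b` is an event of the past of jump `k + 1`, so given it the gap number `k + 1` is still
  -- exponential with rate `L b`.
  set A : S → Set Ω := fun b =>
    occupies X T k a s ∩ {ω | X (k + 1) ω = b ∧ arrival T (k + 1) ω ≤ s + u} with hA
  have hpast : ∀ b, MeasurableSet[past X T (k + 1)] (A b) := by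
    intro b
    have h₁ := measurable_arrival_past (X := X) (T := T) (k + 1) k.le_succ
    have h₂ := measurable_arrival_past (X := X) (T := T) (k + 1) le_rfl
    have h₃ := measurable_state_past (X := X) (T := T) k.le_succ
    have h₄ := measurable_state_past (X := X) (T := T) (k := k + 1) le_rfl
    exact ((h₃ (.singleton a)).inter ((h₁ measurableSet_Iic).inter (h₂ measurableSet_Ioi))).inter
      ((h₄ (.singleton b)).inter (h₂ measurableSet_Iic))
  rw [← sum_measure_inter_eq (h.measurable_state (k + 1))]
  have hstep : ∀ b, P (occupies X T k a s ∩
        {ω | arrival T (k + 1) ω ≤ s + u ∧ T (k + 1) ω ≤ u} ∩ {ω | X (k + 1) ω = b}) =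
      P (occupies X T k a s) * ENNReal.ofReal (stepProb L κ a b u) *
        ENNReal.ofReal (1 - Real.exp (-((L b : ℝ) * u))) := by
    intro b
    rw [← h.measure_occupies_inter hT, ← sum_measure_inter_eq (h.measurable_state (k + 2)),
      ← h.sum_stepProb, Finset.mul_sum]
    refine Finset.sum_congr rfl fun c _ => ?_
    have h₁ := h.measure_past_inter hT (hpast b) b c u
    have h₂ : A b ∩ {ω | X (k + 1) ω = b} = A b := Set.inter_eq_left.2 fun ω hω => hω.2.1
    rw [h₂] at h₁
    rw [← h₁]
    congr 1
    ext ω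
    simp only [hA, Set.mem_inter_iff, Set.mem_ofPred_eq]
    tauto
  simp only [hstep]
  calc ∑ b, P (occupies X T k a s) * ENNReal.ofReal (stepProb L κ a b u) *
        ENNReal.ofReal (1 - Real.exp (-((L b : ℝ) * u)))
      ≤ ∑ b, P (occupies X T k a s) * ENNReal.ofReal (stepProb L κ a b u) *
        ENNReal.ofReal (M * u) := by
        gcongr with b
        exact hexp b
    _ = P (occupies X T k a s) * (ENNReal.ofReal (1 - Real.exp (-((L a : ℝ) * u))) *
          ENNReal.ofReal (M * u)) := by
        rw [← Finset.sum_mul, ← Finset.mul_sum, h.sum_stepProb, mul_assoc]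
    _ ≤ _ := by
        rw [← ENNReal.ofReal_mul (one_sub_exp_nonneg _ _), sq]
        gcongr
        exact hexp a

end Holding

end JumpLaw

/-! ### Paths between consecutive jumps. -/

section Paths

variable {S : Type*} (f : ℝ≥0 → S)

theorem jumpTime_le_succ (k : ℕ) : jumpTime f k ≤ jumpTime f (k + 1) :=
  le_iInf₂ fun _ h => h.1.le

variable {f}

theorem eq_jumpState {k : ℕ} {t : ℝ≥0} (h₁ : jumpTime f k ≤ t) (h₂ : t < jumpTime f (k + 1)) :
    f t = jumpState f k := by
  by_contra hne
  rcases h₁.eq_or_lt with h | h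
  · exact hne (by rw [jumpState, h, ENNReal.toNNReal_coe])
  · exact absurd h₂ (not_lt.2 (iInf₂_le t ⟨h, hne⟩))

end Paths

/-! ### From the jump chain to short-time transition probabilities. -/

section MarkovJump

variable {S Ω : Type*} [Fintype S] [MeasurableSpace Ω] {P : Measure Ω} {Z : ℝ≥0 → Ω → S}
  {rate : S → S → ℝ≥0}

theorem totalRate_mul_jumpKernel {a : S} (ha : 0 < totalRate rate a) (b : S) :
    totalRate rate a * jumpKernel rate a b = rate a b :=
  mul_div_cancel₀ _ ha.ne'

theorem sum_jumpKernel {a : S} (ha : 0 < totalRate rate a) : ∑ b, jumpKernel rate a b = 1 := by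
  simp only [jumpKernel]
  rw [← Finset.sum_div]
  exact div_self ha.ne'

section Measurable

variable [MeasurableSpace S] [DiscreteMeasurableSpace S]

omit [Fintype S] [MeasurableSpace S] [DiscreteMeasurableSpace S] in
theorem measure_cylinder_congr {X X' : ℕ → Ω → S} {T T' : ℕ → Ω → ℝ≥0∞}
    (hX : ∀ᵐ ω ∂P, ∀ i, X i ω = X' i ω) (hT : ∀ᵐ ω ∂P, ∀ i, T i ω = T' i ω) (k : ℕ) (a : ℕ → S)
    (r : ℕ → ℝ≥0) : P (cylinder X T k a r) = P (cylinder X' T' k a r) := by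
  refine measure_congr ?_
  filter_upwards [hX, hT] with ω h₁ h₂
  refine propext ?_
  change ω ∈ cylinder X T k a r ↔ ω ∈ cylinder X' T' k a r
  simp only [cylinder, Set.mem_ofPred_eq, h₁, h₂]

/-- The jump chain of a Markov jump process, up to null sets. -/
theorem IsMarkovJumpProcess.exists_hasJumpLaw [IsProbabilityMeasure P]
    (hZ : IsMarkovJumpProcess P Z rate) (hrate : ∀ a, 0 < totalRate rate a) :
    ∃ (X : ℕ → Ω → S) (T : ℕ → Ω → ℝ≥0),
      HasJumpLaw P X (fun i ω => (T i ω : ℝ≥0∞)) (totalRate rate) (jumpKernel rate) ∧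
      (∀ k, Measurable (T k)) ∧
      ∀ᵐ ω ∂P, (∀ k, jumpState (fun u => Z u ω) k = X k ω) ∧
        ∀ k, jumpTime (fun u => Z u ω) k = arrival T k ω := by
  have hXm : ∀ k, AEMeasurable (fun ω => jumpState (fun u => Z u ω) k) P := fun k =>
    NullMeasurable.aemeasurable (f := fun ω => jumpState (fun u => Z u ω) k) fun s _ => by
      have : (fun ω => jumpState (fun u => Z u ω) k) ⁻¹' s =
          ⋃ a ∈ s, {ω | jumpState (fun u => Z u ω) k = a} := by
        ext ω; simp
      rw [this]
      exact .biUnion s.to_countable fun a _ => hZ.jumpState_measurable k a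
  have hTm : ∀ k, AEMeasurable
      (fun ω => jumpTime (fun u => Z u ω) (k + 1) - jumpTime (fun u => Z u ω) k) P := fun k =>
    (hZ.jumpTime_measurable (k + 1)).sub (hZ.jumpTime_measurable k)
  set X : ℕ → Ω → S := fun k => (hXm k).mk with hX
  set T' : ℕ → Ω → ℝ≥0∞ := fun k => (hTm k).mk with hT'
  have haeX : ∀ᵐ ω ∂P, ∀ k, jumpState (fun u => Z u ω) k = X k ω :=
    ae_all_iff.2 fun k => (hXm k).ae_eq_mk
  have haeT' : ∀ᵐ ω ∂P, ∀ k,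
      jumpTime (fun u => Z u ω) (k + 1) - jumpTime (fun u => Z u ω) k = T' k ω :=
    ae_all_iff.2 fun k => (hTm k).ae_eq_mk
  have hlaw : ∀ k a r, P (cylinder X T' k a r) = ENNReal.ofReal (P.real {ω | Z 0 ω = a 0} *
      ∏ i ∈ Finset.range k,
        stepProb (totalRate rate) (jumpKernel rate) (a i) (a (i + 1)) (r i)) := by
    intro k a r
    have := hZ.jumpLaw k a r
    rw [← measure_cylinder_congr haeX haeT', ← ofReal_measureReal]
    exact congrArg _ this
  have h' : HasJumpLaw P X T' (totalRate rate) (jumpKernel rate) := by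
    refine ⟨fun k => (hXm k).measurable_mk, fun k => (hTm k).measurable_mk, fun k a r => ?_, hrate,
      fun a => sum_jumpKernel (hrate a)⟩
    rw [hlaw, hlaw, Finset.prod_range_succ, ← mul_assoc, ENNReal.ofReal_mul]
    exact mul_nonneg measureReal_nonneg (Finset.prod_nonneg fun i _ => stepProb_nonneg _ _ _)
  -- Almost surely all gaps are finite, so the gaps may be taken in `ℝ≥0` and add up to the jump
  -- times.
  have hfin : ∀ᵐ ω ∂P, ∀ k, T' k ω = ((T' k ω).toNNReal : ℝ≥0∞) := by
    filter_upwards [ae_all_iff.2 h'.ae_gap_lt_top] with ω hω k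
    exact (ENNReal.coe_toNNReal (hω k).ne).symm
  refine ⟨X, fun k ω => (T' k ω).toNNReal, ⟨h'.measurable_state,
    fun k => (h'.measurable_gap k).ennreal_toNNReal.coe_nnreal_ennreal, fun k a r => ?_, hrate,
    h'.kernel_sum⟩, fun k => (h'.measurable_gap k).ennreal_toNNReal, ?_⟩
  · have hself : ∀ᵐ ω ∂P, ∀ i, X i ω = X i ω := .of_forall fun _ _ => rfl
    rw [← measure_cylinder_congr hself hfin, ← measure_cylinder_congr hself hfin]
    exact h'.step k a r
  · filter_upwards [haeX, haeT', hfin] with ω h₁ h₂ h₃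
    refine ⟨h₁, fun k => ?_⟩
    induction k with
    | zero => simp [jumpTime, arrival]
    | succ k ih =>
      rw [arrival_succ, ENNReal.coe_add, ← ih, ← h₃, ← h₂,
        add_tsub_cancel_of_le (jumpTime_le_succ _ k)]

omit [MeasurableSpace Ω] in
theorem arrival_mono {T : ℕ → Ω → ℝ≥0} (ω : Ω) : Monotone fun k => arrival T k ω :=
  monotone_nat_of_le_succ fun k => by rw [arrival_succ]; exact le_self_add

/-- The transition probabilities over short times. -/
theorem IsMarkovJumpProcess.measure_inter_bounds [IsProbabilityMeasure P]
    (hZ : IsMarkovJumpProcess P Z rate) (hrate : ∀ a, 0 < totalRate rate a) {M : ℝ≥0}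
    (hM : ∀ a, totalRate rate a ≤ M) {a b : S} (hab : a ≠ b) (s u : ℝ≥0) :
    P ({ω | Z s ω = a} ∩ {ω | Z (s + u) ω = b}) ≤ P {ω | Z s ω = a} *
        ENNReal.ofReal (stepProb (totalRate rate) (jumpKernel rate) a b u) +
        P {ω | Z s ω = a} * ENNReal.ofReal ((M * u) ^ 2) ∧
      P {ω | Z s ω = a} * ENNReal.ofReal (stepProb (totalRate rate) (jumpKernel rate) a b u) ≤
        P ({ω | Z s ω = a} ∩ {ω | Z (s + u) ω = b}) +
        P {ω | Z s ω = a} * ENNReal.ofReal ((M * u) ^ 2) := by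
  obtain ⟨X, T, hlaw, hT, hae⟩ := hZ.exists_hasJumpLaw hrate
  have hτ : ∀ k, Measurable (arrival T k) := fun k => Finset.measurable_sum _ fun i _ => hT i
  have hpath : ∀ᵐ ω ∂P, ∀ k t, arrival T k ω ≤ t → t < arrival T (k + 1) ω → Z t ω = X k ω := by
    filter_upwards [hae] with ω hω k t h₁ h₂
    rw [← hω.1]
    refine eq_jumpState (f := fun u => Z u ω) ?_ ?_
    · rw [hω.2]; exact_mod_cast h₁
    · rw [hω.2]; exact_mod_cast h₂
  -- Jumps do not accumulate, so `s` lies in some holding interval. Hence the events `occupies X T k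
  -- a s` partition `{Z s = a}` up to a null set.
  have hex : ∀ᵐ ω ∂P, ∃ k, arrival T k ω ≤ s ∧ s < arrival T (k + 1) ω := by
    filter_upwards [hae, hZ.isolatedJumps] with ω hω hω'
    classical
    have h' : ∃ k, s < arrival T k ω := by
      obtain ⟨k, hk⟩ := hω' s
      exact ⟨k, by rw [hω.2] at hk; exact_mod_cast hk⟩
    have hpos : Nat.find h' ≠ 0 := fun h0 => by
      have := Nat.find_spec h'
      rw [h0] at this
      simp [arrival] at this
    obtain ⟨k, hk⟩ := Nat.exists_eq_succ_of_ne_zero hpos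
    exact ⟨k, not_lt.1 (Nat.find_min h' (by omega)), by simpa [hk] using Nat.find_spec h'⟩
  have hmocc : ∀ k, MeasurableSet (occupies X T k a s) := fun k =>
    (hlaw.measurable_state k (.singleton a)).inter
      ((hτ k measurableSet_Iic).inter (hτ (k + 1) measurableSet_Ioi))
  have hdisj : Pairwise (Function.onFun Disjoint fun k => occupies X T k a s) := by
    have : ∀ i j, i < j → Disjoint (occupies X T i a s) (occupies X T j a s) := by
      intro i j hij
      rw [Set.disjoint_left]
      intro ω h₁ h₂
      exact absurd (h₁.2.2.trans_le ((arrival_mono ω (Nat.succ_le_of_lt hij)).trans h₂.2.1))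
        (lt_irrefl _)
    intro i j hij
    rcases lt_or_gt_of_ne hij with h | h
    · exact this i j h
    · exact (this j i h).symm
  have hunion : ∀ B : Set Ω, MeasurableSet B →
      P ({ω | Z s ω = a} ∩ B) = ∑' k, P (occupies X T k a s ∩ B) := by
    intro B hB
    rw [← measure_iUnion (fun i j hij => (hdisj hij).mono Set.inter_subset_left
      Set.inter_subset_left) fun k => (hmocc k).inter hB]
    refine measure_congr ?_
    filter_upwards [hpath, hex] with ω h₁ ⟨k, hk₁, hk₂⟩
    refine propext ?_
    change ω ∈ {ω | Z s ω = a} ∩ B ↔ ω ∈ ⋃ k, occupies X T k a s ∩ B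
    simp only [Set.mem_inter_iff, Set.mem_iUnion, Set.mem_ofPred_eq]
    constructor
    · rintro ⟨h, hB⟩
      exact ⟨k, ⟨(h₁ k s hk₁ hk₂).symm.trans h, hk₁, hk₂⟩, hB⟩
    · rintro ⟨j, ⟨h, hj₁, hj₂⟩, hB⟩
      exact ⟨(h₁ j s hj₁ hj₂).trans h, hB⟩
  have hunion' : P {ω | Z s ω = a} = ∑' k, P (occupies X T k a s) := by
    simpa using hunion Set.univ .univ
  have hsecond : ∀ k ω, s < arrival T (k + 1) ω → ¬ T (k + 1) ω ≤ u →
      s + u < arrival T (k + 2) ω := fun k ω h₁ h₂ => by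
    rw [arrival_succ]
    exact add_lt_add h₁ (not_le.1 h₂)
  rw [hunion _ (hZ.measurable _ _), hunion', ← ENNReal.tsum_mul_right, ← ENNReal.tsum_mul_right,
    ← ENNReal.tsum_add, ← ENNReal.tsum_add]
  constructor
  -- As `a ≠ b`, some jump occurs by time `s + u`. Unless the following gap is at most `u`, it is
  -- the only one and must lead to `b`.
  · refine ENNReal.tsum_le_tsum fun k => ?_
    rw [← hlaw.measure_occupies_inter hT]
    refine le_trans ?_ (add_le_add_right (hlaw.measure_occupies_inter_two hT hM k a s u) _)
    refine le_trans (measure_mono_ae ?_) (measure_union_le _ _)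
    filter_upwards [hpath] with ω hω ⟨hocc, hb⟩
    have h₁ : arrival T (k + 1) ω ≤ s + u := by
      by_contra hcon
      exact hab (hocc.1.symm.trans ((hω k (s + u) (hocc.2.1.trans le_self_add)
        (not_le.1 hcon)).symm.trans hb))
    by_cases h₂ : T (k + 1) ω ≤ u
    · exact Or.inr ⟨hocc, h₁, h₂⟩
    · exact Or.inl ⟨hocc, (hω (k + 1) (s + u) h₁ (hsecond k ω hocc.2.2 h₂)).symm.trans hb, h₁⟩
  · refine ENNReal.tsum_le_tsum fun k => ?_
    rw [← hlaw.measure_occupies_inter hT]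
    refine le_trans ?_ (add_le_add_right (hlaw.measure_occupies_inter_two hT hM k a s u) _)
    refine le_trans (measure_mono_ae ?_) (measure_union_le _ _)
    filter_upwards [hpath] with ω hω ⟨hocc, hb, h₁⟩
    by_cases h₂ : T (k + 1) ω ≤ u
    · exact Or.inr ⟨hocc, h₁, h₂⟩
    · exact Or.inl ⟨hocc, (hω (k + 1) (s + u) h₁ (hsecond k ω hocc.2.2 h₂)).trans hb⟩

end Measurable

/-- This is `1 - exp (-x) = x + O(x²)` at `x = Λ(a) u`, together with `Λ(a) κ_a{b} = λ(a ↷ b)`. -/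
theorem abs_stepProb_sub_le {a b : S} (ha : 0 < totalRate rate a) {M : ℝ≥0}
    (hM : totalRate rate a ≤ M) (u : ℝ≥0) :
    |stepProb (totalRate rate) (jumpKernel rate) a b u - u * rate a b| ≤ (M * u : ℝ) ^ 2 := by
  have hκ : (jumpKernel rate a b : ℝ) ≤ 1 := by
    have h := Finset.single_le_sum (f := jumpKernel rate a) (fun _ _ => zero_le)
      (Finset.mem_univ b)
    rw [sum_jumpKernel ha] at h
    exact_mod_cast h
  have hκ0 : (0 : ℝ) ≤ jumpKernel rate a b := NNReal.coe_nonneg _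
  have hr : (rate a b : ℝ) = totalRate rate a * jumpKernel rate a b := by
    rw [← totalRate_mul_jumpKernel ha b]; push_cast; rfl
  rw [stepProb, hr]
  set x : ℝ := (totalRate rate a : ℝ) * u with hx
  have hx0 : 0 ≤ x := by positivity
  have hxM : x ≤ M * u := mul_le_mul_of_nonneg_right (by exact_mod_cast hM) u.2
  have h₁ := Real.add_one_le_exp (-x)
  -- From `exp (-x) (1 + x) ≤ 1 ≤ 1 + x³ = (1 - x + x²)(1 + x)`.
  have h₂ : Real.exp (-x) ≤ 1 - x + x ^ 2 := by
    have h₃ := Real.add_one_le_exp x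
    have h₄ : Real.exp (-x) * Real.exp x = 1 := by rw [← Real.exp_add]; simp
    have h₅ : 0 < Real.exp (-x) := Real.exp_pos _
    have h₆ : Real.exp (-x) * (x + 1) ≤ 1 :=
      (mul_le_mul_of_nonneg_left h₃ h₅.le).trans h₄.le
    nlinarith [pow_nonneg hx0 3]
  have hsq : x ^ 2 ≤ (M * u : ℝ) ^ 2 := by gcongr
  have heq : (1 - Real.exp (-x)) * (jumpKernel rate a b : ℝ) -
      u * (totalRate rate a * jumpKernel rate a b) =
      -((Real.exp (-x) - 1 + x) * jumpKernel rate a b) := by rw [hx]; ring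
  rw [heq, abs_neg, abs_of_nonneg (mul_nonneg (by linarith) hκ0)]
  calc (Real.exp (-x) - 1 + x) * (jumpKernel rate a b : ℝ) ≤ (Real.exp (-x) - 1 + x) * 1 := by
        gcongr; linarith
    _ ≤ _ := by linarith

theorem real_cond_apply {A : Set Ω} (hA : MeasurableSet A) (B : Set Ω) :
    (P[|A]).real B = (P.real A)⁻¹ * P.real (A ∩ B) := by
  rw [Measure.real, cond_apply hA, ENNReal.toReal_mul, ENNReal.toReal_inv]
  rfl

theorem sum_measureReal_inter_eq [IsFiniteMeasure P] {X : Ω → S}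
    (hX : ∀ b, MeasurableSet {ω | X ω = b}) (A : Set Ω) :
    ∑ b, P.real (A ∩ {ω | X ω = b}) = P.real A := by
  let _ : MeasurableSpace S := ⊤
  have : DiscreteMeasurableSpace S := ⟨fun _ => trivial⟩
  have h := sum_measure_inter_eq (P := P) (measurable_to_countable' hX) A
  simp only [Measure.real]
  rw [← ENNReal.toReal_sum fun b _ => measure_ne_top _ _, h]

/-! ### Forward equation, positivity, convergence and stationarity. -/

section Transition

variable [IsProbabilityMeasure P] (hZ : IsMarkovJumpProcess P Z rate)

include hZ

theorem IsMarkovJumpProcess.sum_transProb {s t : ℝ≥0} {a : S} (h : P {ω | Z s ω = a} ≠ 0) :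
    ∑ b, transProb P Z s t a b = 1 := by
  have := cond_isProbabilityMeasure h
  have h' := sum_measureReal_inter_eq (P := P[|{ω | Z s ω = a}]) (hZ.measurable t) Set.univ
  simpa [transProb] using h'

/-- Null states are included, since both sides vanish there. -/
theorem IsMarkovJumpProcess.mul_transProb (s t : ℝ≥0) (a b : S) :
    P.real {ω | Z s ω = a} * transProb P Z s t a b =
      P.real ({ω | Z s ω = a} ∩ {ω | Z t ω = b}) := by
  rw [transProb, real_cond_apply (hZ.measurable s a)]
  by_cases h : P.real {ω | Z s ω = a} = 0
  · have : P.real ({ω | Z s ω = a} ∩ {ω | Z t ω = b}) = 0 :=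
      le_antisymm (h ▸ measureReal_mono Set.inter_subset_left) measureReal_nonneg
    rw [h, this]; simp
  · rw [← mul_assoc, mul_inv_cancel₀ h, one_mul]

theorem IsMarkovJumpProcess.transProb_self {s : ℝ≥0} {a : S} [DecidableEq S]
    (h : P {ω | Z s ω = a} ≠ 0) : transProb P Z s s a = Pi.single a 1 := by
  have h' : P.real {ω | Z s ω = a} ≠ 0 := fun h0 => h ((measureReal_eq_zero_iff).1 h0)
  ext b
  rw [transProb, real_cond_apply (hZ.measurable s a), Pi.single_apply]
  split_ifs with hb
  · subst hb
    rw [Set.inter_self, inv_mul_cancel₀ h']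
  · have : {ω | Z s ω = a} ∩ {ω | Z s ω = b} = ∅ :=
      Set.eq_empty_of_forall_notMem fun ω hω => hb (hω.2.symm.trans hω.1)
    rw [this]; simp

variable (hrate : ∀ a, 0 < totalRate rate a) (hself : ∀ a, rate a a = 0)

include hrate hself

/-- The transition probabilities to first order. -/
theorem IsMarkovJumpProcess.exists_transProb_approx [DecidableEq S] : ∃ C : ℝ, 0 ≤ C ∧
    ∀ (s u : ℝ≥0) (a b : S), P {ω | Z s ω = a} ≠ 0 →
      |transProb P Z s (s + u) a b -
        ((if a = b then 1 - u * (totalRate rate a : ℝ) else 0) + u * rate a b)| ≤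
        C * (u : ℝ) ^ 2 := by
  let _ : MeasurableSpace S := ⊤
  have : DiscreteMeasurableSpace S := ⟨fun _ => trivial⟩
  set M : ℝ≥0 := ∑ a, totalRate rate a with hMdef
  have hM : ∀ a, totalRate rate a ≤ M := fun a =>
    Finset.single_le_sum (f := totalRate rate) (fun _ _ => zero_le) (Finset.mem_univ a)
  -- One quadratic error comes from a second jump, the other from linearising `stepProb`.
  have hoff : ∀ (s u : ℝ≥0) (a b : S), P {ω | Z s ω = a} ≠ 0 → a ≠ b →
      |transProb P Z s (s + u) a b - u * rate a b| ≤ 2 * (M * u : ℝ) ^ 2 := by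
    intro s u a b ha hab
    have ha' : 0 < P.real {ω | Z s ω = a} :=
      lt_of_le_of_ne measureReal_nonneg fun h0 => ha ((measureReal_eq_zero_iff).1 h0.symm)
    obtain ⟨h₁, h₂⟩ := hZ.measure_inter_bounds hrate hM hab s u
    have hs := stepProb_nonneg (L := totalRate rate) (κ := jumpKernel rate) a b u
    have hq : (0 : ℝ) ≤ (M * u : ℝ) ^ 2 := by positivity
    have hstep := abs_le.1 (abs_stepProb_sub_le (b := b) (hrate a) (hM a) u)
    set p := stepProb (totalRate rate) (jumpKernel rate) a b u with hp
    rw [← ofReal_measureReal, ← ofReal_measureReal (s := {ω | Z s ω = a}),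
      ← ENNReal.ofReal_mul ha'.le, ← ENNReal.ofReal_mul ha'.le,
      ← ENNReal.ofReal_add (by positivity) (by positivity),
      ENNReal.ofReal_le_ofReal_iff (by positivity), ← hZ.mul_transProb, ← mul_add,
      mul_le_mul_iff_right₀ ha'] at h₁
    have ht0 : 0 ≤ transProb P Z s (s + u) a b := measureReal_nonneg
    rw [← ofReal_measureReal, ← ofReal_measureReal (s := {ω | Z s ω = a} ∩ _),
      ← ENNReal.ofReal_mul ha'.le, ← ENNReal.ofReal_mul ha'.le,
      ← ENNReal.ofReal_add measureReal_nonneg (by positivity), ← hZ.mul_transProb, ← mul_add,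
      ENNReal.ofReal_le_ofReal_iff (by positivity), mul_le_mul_iff_right₀ ha'] at h₂
    rw [abs_le]
    constructor <;> linarith
  have hC : 2 * (M : ℝ) ^ 2 ≤ (Fintype.card S + 1) * (2 * (M : ℝ) ^ 2) := by
    have : (0 : ℝ) ≤ Fintype.card S := by positivity
    nlinarith [sq_nonneg (M : ℝ)]
  refine ⟨(Fintype.card S + 1) * (2 * (M : ℝ) ^ 2), by positivity, fun s u a b ha => ?_⟩
  -- The diagonal entry follows from the others because rows sum to one; this brings the number of
  -- states into the constant.
  by_cases hab : a = b
  · subst hab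
    rw [if_pos rfl, hself, NNReal.coe_zero, mul_zero, add_zero]
    have h₁ := hZ.sum_transProb (t := s + u) ha
    rw [← Finset.add_sum_erase _ _ (Finset.mem_univ a)] at h₁
    have h₂ : (totalRate rate a : ℝ) = ∑ b ∈ Finset.univ.erase a, (rate a b : ℝ) := by
      rw [totalRate, NNReal.coe_sum, ← Finset.add_sum_erase _ _ (Finset.mem_univ a), hself]
      simp
    have h₃ : transProb P Z s (s + u) a a - (1 - u * (totalRate rate a : ℝ)) =
        -∑ b ∈ Finset.univ.erase a, (transProb P Z s (s + u) a b - u * rate a b) := by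
      rw [h₂, Finset.sum_sub_distrib, ← Finset.mul_sum]
      linarith
    rw [h₃, abs_neg]
    calc |∑ b ∈ Finset.univ.erase a, (transProb P Z s (s + u) a b - u * rate a b)|
        ≤ ∑ b ∈ Finset.univ.erase a, 2 * (M * u : ℝ) ^ 2 :=
          (Finset.abs_sum_le_sum_abs _ _).trans (Finset.sum_le_sum fun b hb =>
            hoff s u a b ha (Finset.ne_of_mem_erase hb).symm)
      _ ≤ ∑ b : S, 2 * (M * u : ℝ) ^ 2 :=
          Finset.sum_le_sum_of_subset_of_nonneg (Finset.erase_subset _ _)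
            fun _ _ _ => by positivity
      _ = Fintype.card S * (2 * (M : ℝ) ^ 2 * (u : ℝ) ^ 2) := by
          rw [Finset.sum_const, Finset.card_univ, nsmul_eq_mul]; ring
      _ ≤ _ := by nlinarith [mul_nonneg (sq_nonneg (M : ℝ)) (sq_nonneg (u : ℝ))]
  · rw [if_neg hab, zero_add]
    calc _ ≤ 2 * (M * u : ℝ) ^ 2 := hoff s u a b ha hab
      _ = 2 * (M : ℝ) ^ 2 * (u : ℝ) ^ 2 := by ring
      _ ≤ _ := by gcongr

/-- Covers both the law of `Z t` and the conditional law given `Z s = a`. The support condition `hP`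
excludes null states, for which `transProb` carries no information. -/
theorem IsMarkovJumpProcess.isFlow_of_transProb {f : ℝ≥0 → S → ℝ} {s : ℝ≥0}
    (hf0 : ∀ t b, 0 ≤ f t b) (hf1 : ∀ t, ∑ b, f t b = 1)
    (hP : ∀ t c, f t c ≠ 0 → P {ω | Z (s + t) ω = c} ≠ 0)
    (hf : ∀ t h b, f (t + h) b = ∑ c, f t c * transProb P Z (s + t) (s + t + h) c b) :
    IsFlow rate f := by
  classical
  obtain ⟨C, hC0, hC⟩ := hZ.exists_transProb_approx hrate hself
  refine ⟨⟨1, fun t => (pi_norm_le_iff_of_nonneg zero_le_one).2 fun b => ?_⟩, C, fun t h _ =>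
    (pi_norm_le_iff_of_nonneg (by positivity)).2 fun b => ?_⟩
  · rw [Real.norm_of_nonneg (hf0 t b), ← hf1 t]
    exact Finset.single_le_sum (fun c _ => hf0 t c) (Finset.mem_univ b)
  · have heq : (f (t + h) - f t - (h : ℝ) • generator rate (f t)) b =
        ∑ c, f t c * (transProb P Z (s + t) (s + t + h) c b -
          ((if c = b then 1 - h * (totalRate rate c : ℝ) else 0) + h * rate c b)) := by
      simp only [Pi.sub_apply, Pi.smul_apply, smul_eq_mul, generator_apply, hf, mul_sub, mul_add,
        mul_ite, mul_zero, Finset.sum_sub_distrib, Finset.sum_add_distrib, Finset.sum_ite_eq',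
        Finset.mem_univ, if_true, Finset.mul_sum]
      have : ∀ c, (h : ℝ) * (f t c * rate c b) = f t c * (h * rate c b) := fun c => by ring
      simp only [this]
      ring
    rw [heq, Real.norm_eq_abs]
    calc _ ≤ ∑ c, f t c * (C * (h : ℝ) ^ 2) := by
          refine (Finset.abs_sum_le_sum_abs _ _).trans (Finset.sum_le_sum fun c _ => ?_)
          rw [abs_mul, abs_of_nonneg (hf0 t c)]
          by_cases hc : f t c = 0
          · simp [hc]
          · exact mul_le_mul_of_nonneg_left (hC (s + t) h c b (hP t c hc)) (hf0 t c)
      _ = C * (h : ℝ) ^ 2 := by rw [← Finset.sum_mul, hf1, one_mul]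

theorem IsMarkovJumpProcess.isFlow_law : IsFlow rate fun t b => P.real {ω | Z t ω = b} := by
  refine hZ.isFlow_of_transProb hrate hself (s := 0) (fun _ _ => measureReal_nonneg) (fun t => ?_)
    (fun t c hc h0 => hc ?_) fun t h b => ?_
  · simpa using sum_measureReal_inter_eq (P := P) (hZ.measurable t) Set.univ
  · rw [zero_add] at h0
    exact (measureReal_eq_zero_iff).2 h0
  · simp only [zero_add, hZ.mul_transProb]
    rw [← sum_measureReal_inter_eq (hZ.measurable t)]
    simp only [Set.inter_comm]

theorem IsMarkovJumpProcess.isFlow_transProb {s : ℝ≥0} {a : S} (ha : P {ω | Z s ω = a} ≠ 0) :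
    IsFlow rate fun t => transProb P Z s (s + t) a := by
  have := cond_isProbabilityMeasure ha
  have hmA := hZ.measurable s a
  refine hZ.isFlow_of_transProb hrate hself (s := s) (fun _ _ => measureReal_nonneg)
    (fun t => hZ.sum_transProb ha) (fun t c hc h0 => hc ?_) fun t h b => ?_
  · rw [transProb, real_cond_apply hmA,
      le_antisymm ((measureReal_mono Set.inter_subset_right).trans
        ((measureReal_eq_zero_iff).2 h0).le) measureReal_nonneg, mul_zero]
  · rw [transProb, ← sum_measureReal_inter_eq (hZ.measurable (s + t)), ← add_assoc]
    refine Finset.sum_congr rfl fun c _ => ?_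
    rw [transProb, real_cond_apply hmA, real_cond_apply hmA, mul_assoc]
    congr 1
    have hmAc : MeasurableSet ({ω | Z s ω = a} ∩ {ω | Z (s + t) ω = c}) :=
      hmA.inter (hZ.measurable _ _)
    by_cases hc : P ({ω | Z s ω = a} ∩ {ω | Z (s + t) ω = c}) = 0
    · have h₁ := (measureReal_eq_zero_iff (μ := P)).2 hc
      rw [h₁, zero_mul]
      refine le_antisymm (h₁ ▸ measureReal_mono fun ω hω => ⟨hω.1, hω.2.2⟩) measureReal_nonneg
    · have hset : {ω | (∀ i : Fin 1, Z ((fun _ => s) i) ω = (fun _ => a) i) ∧ Z (s + t) ω = c} =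
          {ω | Z s ω = a} ∩ {ω | Z (s + t) ω = c} := by
        ext ω; simp
      -- The Markov property with the single past time `s` gives the Chapman-Kolmogorov equation.
      have h₁ := hZ.markov 1 (fun _ => s) (fun _ => a) (s + t) (s + t + h) c b
        (fun _ => le_self_add) le_self_add (by rwa [hset])
      rw [hset, real_cond_apply hmAc] at h₁
      have h₂ : P.real ({ω | Z s ω = a} ∩ {ω | Z (s + t) ω = c}) ≠ 0 := fun h0 =>
        hc ((measureReal_eq_zero_iff).1 h0)
      rw [← h₁, ← mul_assoc, mul_inv_cancel₀ h₂, one_mul]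
      congr 1
      ext ω
      simp only [Set.mem_inter_iff, Set.mem_ofPred_eq]
      tauto

theorem IsMarkovJumpProcess.transProb_eq_semigroup [DecidableEq S] {s : ℝ≥0} {a : S}
    (ha : P {ω | Z s ω = a} ≠ 0) (t : ℝ≥0) :
    transProb P Z s (s + t) a = semigroup rate t (Pi.single a 1) := by
  rw [(hZ.isFlow_transProb hrate hself ha).eq_semigroup t, add_zero, hZ.transProb_self ha]

variable (hirr : ∀ a b, Relation.ReflTransGen (fun a b => 0 < rate a b) a b)

include hirr

theorem IsMarkovJumpProcess.measure_pos {s : ℝ≥0} (hs : 0 < s) (a : S) :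
    0 < P {ω | Z s ω = a} := by
  have hsum := sum_measureReal_inter_eq (P := P) (hZ.measurable 0) Set.univ
  simp only [Set.univ_inter, probReal_univ] at hsum
  obtain ⟨c, -, hc⟩ := Finset.exists_ne_zero_of_sum_ne_zero (hsum ▸ one_ne_zero)
  have h := congrFun ((hZ.isFlow_law hrate hself).eq_semigroup s) a
  have hpos := semigroup_pos rate hirr (t := s) (by exact_mod_cast hs)
    (v := fun b => P.real {ω | Z 0 ω = b}) (fun _ => measureReal_nonneg)
    (lt_of_le_of_ne measureReal_nonneg hc.symm) a
  rw [← h] at hpos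
  exact pos_of_ne_zero fun h0 => hpos.ne' ((measureReal_eq_zero_iff).2 h0)

theorem IsMarkovJumpProcess.transProb_pos {s t : ℝ≥0} {a : S} (ha : P {ω | Z s ω = a} ≠ 0)
    (hst : s < t) (b : S) : 0 < transProb P Z s t a b := by
  classical
  obtain ⟨u, rfl⟩ := exists_add_of_le hst.le
  rw [hZ.transProb_eq_semigroup hrate hself ha]
  have hu : 0 < u := by simpa using hst
  exact semigroup_pos rate hirr (by exact_mod_cast hu) (single_one_nonneg a) (a := a) (by simp) b

variable {p : S → ℝ} (hp : generator rate p = 0) (hp1 : ∑ a, p a = 1)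

include hp hp1

/-- The transition probabilities and the constant curve `p` are flows of total mass one; their
difference has mass zero and tends to zero. -/
theorem IsMarkovJumpProcess.tendsto_transProb {s : ℝ≥0} {a : S} (ha : P {ω | Z s ω = a} ≠ 0)
    (b : S) : Tendsto (fun t => transProb P Z s t a b) atTop (𝓝 (p b)) := by
  have hf := hZ.isFlow_transProb hrate hself ha
  have h₁ := (hf.sub (isFlow_const hp)).tendsto_zero hirr (fun t => by
    simp only [Pi.sub_apply, Finset.sum_sub_distrib, hZ.sum_transProb ha, hp1, sub_self]) b
  have h₂ : Tendsto (fun t : ℝ≥0 => t - s) atTop atTop :=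
    tendsto_atTop.2 fun r => by
      filter_upwards [eventually_ge_atTop (r + s)] with t ht
      exact le_tsub_of_add_le_right ht
  have h₃ := (h₁.comp h₂).add_const (p b)
  rw [zero_add] at h₃
  refine h₃.congr' ?_
  filter_upwards [eventually_ge_atTop s] with t ht
  simp [add_tsub_cancel_of_le ht]

theorem IsMarkovJumpProcess.isEquilibrium_iff (μ : S → ℝ≥0) :
    IsEquilibrium P Z μ ↔ ∀ a, (μ a : ℝ) = p a := by
  classical
  have hne : ∀ {s : ℝ≥0}, 0 < s → ∀ a, P {ω | Z s ω = a} ≠ 0 := fun hs a =>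
    (hZ.measure_pos hrate hself hirr hs a).ne'
  have hB : ∀ s t : ℝ≥0, 0 < s → ∀ B : Finset S,
      ∑ a, (P[|{ω | Z s ω = a}]).real {ω | Z t ω ∈ B} * (μ a : ℝ) =
        ∑ b ∈ B, ∑ a, transProb P Z s t a b * μ a := by
    intro s t hs B
    rw [Finset.sum_comm]
    refine Finset.sum_congr rfl fun a _ => ?_
    rw [← Finset.sum_mul]
    congr 1
    have := cond_isProbabilityMeasure (hne hs a)
    have hset : {ω | Z t ω ∈ B} = ⋃ b ∈ B, {ω | Z t ω = b} := by ext ω; simp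
    rw [hset, measureReal_biUnion_finset _ fun b _ => hZ.measurable t b]
    · rfl
    · intro b _ c _ hbc
      exact Set.disjoint_left.2 fun ω h₁ h₂ => hbc (h₁.symm.trans h₂)
  constructor
  · rintro ⟨hsum, hμ⟩ b
    have hsum' : ∑ a, (μ a : ℝ) = 1 := by exact_mod_cast hsum
    -- Let `t → ∞` in the equilibrium equation with `s = 1`; at any positive time all states have
    -- positive probability, so every row converges to `p`.
    have h₁ : Tendsto (fun t => ∑ a, transProb P Z 1 t a b * μ a) atTop (𝓝 (∑ a, p b * μ a)) :=
      tendsto_finsetSum _ fun a _ => (hZ.tendsto_transProb hrate hself hirr hp hp1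
        (hne one_pos a) b).mul_const _
    rw [← Finset.mul_sum, hsum', mul_one] at h₁
    refine tendsto_nhds_unique (tendsto_const_nhds.congr' ?_) h₁
    filter_upwards [eventually_gt_atTop 1] with t ht
    have h₂ := hμ 1 t one_pos ht {b}
    rw [hB 1 t one_pos, Finset.sum_singleton, Finset.sum_singleton] at h₂
    exact h₂.symm
  · intro hμ
    refine ⟨by exact_mod_cast (Finset.sum_congr rfl fun a _ => hμ a).trans hp1,
      fun s t hs hst B => ?_⟩
    rw [hB s t hs]
    refine Finset.sum_congr rfl fun b _ => ?_
    obtain ⟨u, rfl⟩ := exists_add_of_le hst.le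
    have h₁ := congrFun ((isFlow_const hp).eq_semigroup u) b
    have h₂ : p = ∑ a, p a • (Pi.single a 1 : S → ℝ) := by
      ext c; simp [Finset.sum_apply, Pi.single_apply]
    rw [hμ b, h₁]
    conv_rhs => rw [h₂]
    rw [map_sum, Finset.sum_apply]
    refine Finset.sum_congr rfl fun a _ => ?_
    rw [hZ.transProb_eq_semigroup hrate hself (hne hs a), map_smul, Pi.smul_apply, smul_eq_mul,
      hμ a, mul_comm]

end Transition

end MarkovJump

/-! ### Application to the Causal Zig-Zag process. -/

theorem generator_zigZagRate {n : ℕ} {g : ℝ≥0 → ℝ≥0} {π : CPDAG n → ℝ≥0} (hg : IsBalancing g)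
    (hπ : ∀ γ, 0 < π γ) : generator (zigZagRate g π) (fun a => (π a.1 : ℝ) / 2) = 0 := by
  ext b
  have h := sum_mul_zigZagRate hg hπ b
  have h' : ∀ a : State n, (π a.1 : ℝ) / 2 * zigZagRate g π a b =
      (π a.1 : ℝ) * zigZagRate g π a b / 2 := fun a => by ring
  simp only [generator_apply, h', ← Finset.sum_div, h, Pi.zero_apply]
  ring

theorem sum_half {n : ℕ} {π : CPDAG n → ℝ≥0} (hπ : ∑ γ, π γ = 1) :
    ∑ a : State n, (π a.1 : ℝ) / 2 = 1 := by
  have h : ∑ γ, (π γ : ℝ) = 1 := by exact_mod_cast hπ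
  rw [sum_state 1]
  simp only [← Finset.sum_div, h]
  norm_num

end CausalZigZag

theorem mainTheorem1 (n : ℕ) (hn : 2 ≤ n)
    (g : ℝ≥0 → ℝ≥0) (hg : CausalZigZag.IsBalancing g)
    (π : CausalZigZag.CPDAG n → ℝ≥0) (hπ_sum : ∑ γ, π γ = 1) (hπ_pos : ∀ γ, 0 < π γ)
    {Ω : Type*} [MeasurableSpace Ω] (P : Measure Ω) [IsProbabilityMeasure P]
    (Z : ℝ≥0 → Ω → CausalZigZag.State n)
    (hZ : CausalZigZag.IsMarkovJumpProcess P Z (CausalZigZag.zigZagRate g π)) :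
    -- every state has positive probability at every positive time
    (∀ (s : ℝ≥0) (a : CausalZigZag.State n), 0 < s → 0 < P {ω | Z s ω = a}) ∧
    -- irreducibility
    (∀ (s t : ℝ≥0) (a b : CausalZigZag.State n), s < t → P {ω | Z s ω = a} ≠ 0 →
      0 < CausalZigZag.transProb P Z s t a b) ∧
    -- the unique stationary distribution
    (∀ μ : CausalZigZag.State n → ℝ≥0,
      CausalZigZag.IsEquilibrium P Z μ ↔ ∀ γ d, μ (γ, d) = π γ / 2) ∧
    -- convergence of the transition probabilities
    (∀ (s : ℝ≥0) (a : CausalZigZag.State n) (γ : CausalZigZag.CPDAG n) (d : ℤˣ),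
      P {ω | Z s ω = a} ≠ 0 →
      Tendsto (fun t : ℝ≥0 => CausalZigZag.transProb P Z s t a (γ, d)) atTop
        (𝓝 ((π γ : ℝ) / 2))) := by
  have hrate := CausalZigZag.totalRate_zigZagRate_pos hn hg hπ_pos
  have hself := CausalZigZag.zigZagRate_self (g := g) (π := π)
  have hirr := CausalZigZag.zigZagRate_irreducible hn hg hπ_pos
  have hgen := CausalZigZag.generator_zigZagRate hg hπ_pos
  have hsum := CausalZigZag.sum_half hπ_sum
  refine ⟨fun s a hs => hZ.measure_pos hrate hself hirr hs a,
    fun s t a b hst ha => hZ.transProb_pos hrate hself hirr ha hst b, fun μ => ?_,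
    fun s a γ d ha => hZ.tendsto_transProb hrate hself hirr hgen hsum ha (γ, d)⟩
  rw [hZ.isEquilibrium_iff hrate hself hirr hgen hsum, Prod.forall]
  refine forall₂_congr fun γ d => ?_
  rw [← NNReal.coe_inj]
  push_cast
  rfl
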